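/- Let $q$ be a positive real number that is transcendental over $\mathbb{Q}$. For a vector space $V$ with basis $v_1,\dots,v_n$, let $\hat R_{V,V}$ be the braiding of the standard quantum group on $V\otimes V$: in the basis $v_i\otimes v_j$ its entry in row $(i,j)$ and column $(k,l)$ is $q^{\delta_{ij}}\delta_{il}\delta_{jk}+(q-q^{-1})\delta_{ik}\delta_{jl}\theta(j-i)$, where $\theta(a)=1$ if $a>0$ and $\theta(a)=0$ otherwise. For $\bar X=V\otimes W$ put $\hat R_{\bar X,\bar X}=\hat R_{V,V}\otimes\hat R_{W,W}$, which is diagonalizable on $\bar X\otimes\bar X$ with eigenvalues among $q^2,q^{-2},-1$; let $P_-$ be the projection onto its $(-1)$-eigenspace along the span of the $q^{2}$- and $q^{-2}$-eigenspaces, and $P_+=I-P_-$. Let $\mathcal O(M_q(\bar X))=\mathbb C\langle \mathbf u\rangle/\langle P_+(\mathbf u\otimes\mathbf u)=(\mathbf u\otimes\mathbf u)P_+\rangle$, where $\mathbf u$ is a matrix of $(\dim \bar X)^2$ free variables $z_{i_1i_2,k_1k_2}$ (row $(i_1,i_2)$, column $(k_1,k_2)$), graded by degree; its Poincaré series is $\sum_d\dim(\mathcal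 O(M_q(\bar X))_d)\,t^d$. The same definition is used at $q=1$, with $P_-$ the projection onto the $(-1)$-eigenspace along the $1$-eigenspace. Let $\mathcal O(M(X))$ be the commutative polynomial ring in the entries of $\mathbf u$. Let $\dim V=\dim W=2$. Then: 1. The Poincaré series of $\mathcal O(M_q(\bar X))$ is different from the classical one, that of $\mathcal O(M(X))$, which is also the Poincaré series of $\mathcal O(M_q(\bar X))$ at $q=1$. In degree $3$, $\dim \mathcal O(M_q(\bar X))_3=688$, whereas $\dim\mathcal O(M(X))_3=816$. 2. Order the variables $z_{i_1i_2,k_1k_2}$ lexicographically by $(i_1,i_2,k_1,k_2)$, and call a monomial $z_{A_1}\cdots z_{A_d}$ standard if $A_1\succeq\dots\succeq A_d$. For each nonstandard $z_Az_B$ there is exactly one linear combination $f_{A,B}$ of standard monomials of degree $2$ such that $z_Az_B-f_{A,B}$ is a linear combination of the defining relations. Consider the reduction system with the rules $z_Az_B\to f_{A,B}$, each elementary reduction applying one rule at one place of one monomial. The monomial $z_{11,11}z_{11,12}z_{12,21}$ can be reduced to each of the two distinct linear combinations of standard monomials $$\begin{aligned} l={}&(q^2-1)\,z_{12,11}z_{11,21}z_{11,12}+\tfrac{q^3-q}{1+q^2}\,z_{12,11}z_{11,22}z_{11,11}+\tfrac{q^2-1}{1+q^2}\,z_{12,12}z_{11,21}z_{11,11}\\&+\tfrac{2q^2}{1+q^2}\,z_{12,21}z_{11,12}z_{11,11}+\tfrac{(1-q^2)q}{1+q^2}\,z_{12,22}z_{11,11}z_{11,11},\\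 l'={}&\tfrac{q^6+q^4-3q^2+1}{q^2(1+q^2)}\,z_{12,11}z_{11,21}z_{11,12}+\tfrac{2q^3-2q}{(1+q^2)^2}\,z_{12,11}z_{11,22}z_{11,11}+\tfrac{4q^2+q^4-1}{(1+q^2)^2}\,z_{12,21}z_{11,12}z_{11,11}\\&+\tfrac{2q^2-2}{(1+q^2)^2}\left(z_{12,12}z_{11,21}z_{11,11}-q\,z_{12,22}z_{11,11}z_{11,11}\right). \end{aligned}$$ Hence $l-l'=0$ is a nontrivial relation among standard monomials in $\mathcal O(M_q(\bar X))$, and the reduction system does not have the diamond property: it is not true that each monomial of degree $3$, reduced in any way to a combination of standard monomials, always leads to the same result. -/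

import Mathlib

open scoped Kronecker

namespace QMat

noncomputable section

/-- The matrix of the braiding `R̂ = τ ∘ R` of the standard quantum group of an `n`-dimensional
space, in the basis `v_i ⊗ v_j`: its entry at row `(i, j)`, column `(k, l)` is
`q^{δ_ij} δ_il δ_jk + (q - q⁻¹) δ_ik δ_jl θ(j - i)`. -/
def braiding (n : ℕ) (q : ℂ) : Matrix (Fin n × Fin n) (Fin n × Fin n) ℂ :=
  Matrix.of fun r c =>
    (if r.1 = r.2 then q else 1) * (if r.1 = c.2 ∧ r.2 = c.1 then 1 else 0)
      + (q - q⁻¹) * (if r.1 = c.1 ∧ r.2 = c.2 ∧ r.1 < r.2 then 1 else 0)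

/-- Labels of the basis `x_{ij} = v_i ⊗ w_j` of `X̄ = V ⊗ W`, where `dim V = n`, `dim W = m`. -/
abbrev Idx (n m : ℕ) := Fin n × Fin m

/-- `R̂_{X̄,X̄} = R̂_{V,V} ⊗ R̂_{W,W}`, as a matrix on `X̄ ⊗ X̄`
(`(V ⊗ W) ⊗ (V ⊗ W)` being identified with `(V ⊗ V) ⊗ (W ⊗ W)`). -/
def braidingX (n m : ℕ) (q : ℂ) : Matrix (Idx n m × Idx n m) (Idx n m × Idx n m) ℂ :=
  (braiding n q ⊗ₖ braiding m q).submatrix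
    (Equiv.prodProdProdComm (Fin n) (Fin m) (Fin n) (Fin m))
    (Equiv.prodProdProdComm (Fin n) (Fin m) (Fin n) (Fin m))

/-- The quantum antisymmetric subspace `A_q(X̄ ⊗ X̄)`: the eigenspace of `R̂_{X̄,X̄}` for `-1`. -/
def antisymmetricSubspace (n m : ℕ) (q : ℂ) : Submodule ℂ (Idx n m × Idx n m → ℂ) :=
  Module.End.eigenspace (Matrix.toLin' (braidingX n m q)) (-1)

/-- The quantum symmetric subspace `S_q(X̄ ⊗ X̄)`: the span of the eigenspaces of `R̂_{X̄,X̄}`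
for `q²` and `q⁻²`. -/
def symmetricSubspace (n m : ℕ) (q : ℂ) : Submodule ℂ (Idx n m × Idx n m → ℂ) :=
  Module.End.eigenspace (Matrix.toLin' (braidingX n m q)) (q ^ 2) ⊔
    Module.End.eigenspace (Matrix.toLin' (braidingX n m q)) ((q ^ 2)⁻¹)

/-- The spectral projection `P_-^{X̄}` onto the eigenspace of `R̂_{X̄,X̄}` for `-1` (the other
eigenvalues being `q²` and `q⁻²`), written as a polynomial in `R̂_{X̄,X̄}`. See
`projMinus_isIdempotentElem`, `range_projMinus` and `ker_projMinus`. -/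
def projMinus (n m : ℕ) (q : ℂ) : Matrix (Idx n m × Idx n m) (Idx n m × Idx n m) ℂ :=
  ((-1 - q ^ 2) * (-1 - (q ^ 2)⁻¹))⁻¹ •
    ((braidingX n m q - (q ^ 2) • 1) * (braidingX n m q - ((q ^ 2)⁻¹) • 1))

/-- The complementary spectral projection `P_+^{X̄}`. -/
def projPlus (n m : ℕ) (q : ℂ) : Matrix (Idx n m × Idx n m) (Idx n m × Idx n m) ℂ :=
  1 - projMinus n m q

/-- The Hecke relation `(R̂ - q)(R̂ + q⁻¹) = 0`. -/
theorem braiding_mul_self (n : ℕ) (q : ℂ) (hq : q ≠ 0) :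
    braiding n q * braiding n q = (q - q⁻¹) • braiding n q + 1 := by
  have key : ∀ (M : Matrix (Fin n × Fin n) (Fin n × Fin n) ℂ) (i j : Fin n)
      (c : Fin n × Fin n), (braiding n q * M) (i, j) c =
        (if i = j then q else 1) * M (j, i) c
          + (q - q⁻¹) * (if i < j then M (i, j) c else 0) := by
    intro M i j c
    rw [Matrix.mul_apply]
    simp only [braiding, Matrix.of_apply, add_mul, Finset.sum_add_distrib]
    congr 1
    · rw [Finset.sum_eq_single (j, i)]
      · simp
      · rintro ⟨a, b⟩ - h
        rw [if_neg (c := i = b ∧ j = a)]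
        · simp
        · rintro ⟨rfl, rfl⟩; exact h rfl
      · simp
    · rw [Finset.sum_eq_single (i, j)]
      · simp
      · rintro ⟨a, b⟩ - h
        rw [if_neg (c := i = a ∧ j = b ∧ i < j)]
        · simp
        · rintro ⟨rfl, rfl, -⟩; exact h rfl
      · simp
  ext ⟨i, j⟩ ⟨k, l⟩
  rw [key]
  simp only [braiding, Matrix.of_apply, Matrix.add_apply, Matrix.smul_apply, smul_eq_mul,
    Matrix.one_apply, Prod.mk.injEq]
  have c1 : (j = k ∧ i = l) ↔ (i = l ∧ j = k) := and_comm
  have c2 : (j = l ∧ i = k) ↔ (i = k ∧ j = l) := and_comm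
  have c3 : (i = k ∧ j = l ∧ i < j) ↔ ((i = k ∧ j = l) ∧ i < j) := and_assoc.symm
  have c4 : (j = k ∧ i = l ∧ j < i) ↔ ((i = l ∧ j = k) ∧ j < i) := by rw [← and_assoc, c1]
  simp only [c2, c3, c4]
  rcases lt_trichotomy i j with h | h | h
  · simp only [h, h.ne, h.ne', h.asymm, if_true, if_false, and_false, and_true]
    ring
  · subst h
    simp only [lt_irrefl, and_false, if_false, if_true]
    by_cases h : i = l ∧ i = k
    · obtain ⟨rfl, rfl⟩ := h
      simp
      field_simp
      ring
    · have h' : ¬ (i = k ∧ i = l) := fun h' => h h'.symm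
      simp [h, h']
  · simp only [h, h.ne, h.ne', h.asymm, if_false, and_false, and_true]
    ring

theorem braidingX_mul_self (n m : ℕ) (q : ℂ) (hq : q ≠ 0) :
    (braidingX n m q + 1) *
      ((braidingX n m q - (q ^ 2) • 1) * (braidingX n m q - ((q ^ 2)⁻¹) • 1)) = 0 := by
  have hV := braiding_mul_self n q hq
  have hW := braiding_mul_self m q hq
  set a := braiding n q
  set b := braiding m q
  set h : ℂ := q - q⁻¹ with hh
  have hs : q ^ 2 + (q ^ 2)⁻¹ = h ^ 2 + 2 := by rw [hh]; field_simp; ring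
  have h1 : (q ^ 2) * (q ^ 2)⁻¹ = 1 := mul_inv_cancel₀ (pow_ne_zero 2 hq)
  set e := Equiv.prodProdProdComm (Fin n) (Fin m) (Fin n) (Fin m)
  set R : Matrix _ _ ℂ := a ⊗ₖ b with hR
  have hX : braidingX n m q = Matrix.reindexAlgEquiv ℂ ℂ e.symm R := rfl
  have hRR : R * R = h ^ 2 • R + h • (a ⊗ₖ (1 : Matrix (Fin m × Fin m) (Fin m × Fin m) ℂ))
      + h • ((1 : Matrix (Fin n × Fin n) (Fin n × Fin n) ℂ) ⊗ₖ b) + 1 := by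
    rw [hR, ← Matrix.mul_kronecker_mul, hV, hW]
    simp only [Matrix.add_kronecker, Matrix.kronecker_add, Matrix.smul_kronecker,
      Matrix.kronecker_smul, Matrix.one_kronecker_one]
    module
  have hRa : R * (a ⊗ₖ (1 : Matrix (Fin m × Fin m) (Fin m × Fin m) ℂ)) =
      h • R + (1 : Matrix (Fin n × Fin n) (Fin n × Fin n) ℂ) ⊗ₖ b := by
    rw [hR, ← Matrix.mul_kronecker_mul, hV, mul_one, Matrix.add_kronecker, Matrix.smul_kronecker]
  have hRb : R * ((1 : Matrix (Fin n × Fin n) (Fin n × Fin n) ℂ) ⊗ₖ b) =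
      h • R + a ⊗ₖ (1 : Matrix (Fin m × Fin m) (Fin m × Fin m) ℂ) := by
    rw [hR, ← Matrix.mul_kronecker_mul, hW, mul_one, Matrix.kronecker_add, Matrix.kronecker_smul]
  have hq2 : (R - (q ^ 2) • 1) * (R - ((q ^ 2)⁻¹) • 1) =
      R * R - (h ^ 2 + 2) • R + 1 := by
    rw [← hs]
    generalize (q ^ 2)⁻¹ = t at h1 ⊢
    simp only [sub_mul, mul_sub, smul_mul_assoc, mul_smul_comm, one_mul, mul_one]
    match_scalars <;> first | ring1 | linear_combination h1
  rw [hX]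
  have := congrArg (Matrix.reindexAlgEquiv ℂ ℂ e.symm)
    (show (R + 1) * ((R - (q ^ 2) • 1) * (R - ((q ^ 2)⁻¹) • 1)) = 0 by
      rw [hq2, hRR]
      simp only [add_mul, mul_add, mul_sub, mul_smul_comm, one_mul, mul_one, hRR, hRa, hRb]
      module)
  simpa only [map_mul, map_add, map_sub, map_smul, map_one, map_zero] using this

theorem braidingX_mul_projMinus (n m : ℕ) (q : ℂ) (hq : q ≠ 0) :
    braidingX n m q * projMinus n m q = - projMinus n m q := by
  have h := braidingX_mul_self n m q hq
  rw [add_mul, one_mul] at h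
  rw [projMinus, mul_smul_comm, eq_neg_of_add_eq_zero_left h, smul_neg]

theorem projMinus_mulVec_of_eigen (n m : ℕ) (q c : ℂ) (v : Idx n m × Idx n m → ℂ)
    (hv : (braidingX n m q).mulVec v = c • v) :
    (projMinus n m q).mulVec v =
      (((-1 - q ^ 2) * (-1 - (q ^ 2)⁻¹))⁻¹ * ((c - q ^ 2) * (c - (q ^ 2)⁻¹))) • v := by
  simp only [projMinus, Matrix.smul_mulVec, ← Matrix.mulVec_mulVec, Matrix.sub_mulVec, hv,
    Matrix.one_mulVec, Matrix.mulVec_sub, Matrix.mulVec_smul]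
  module

theorem range_projMinus (n m : ℕ) (q : ℂ) (hq : q ≠ 0) (hq2 : q ^ 2 ≠ -1) :
    LinearMap.range (Matrix.toLin' (projMinus n m q)) = antisymmetricSubspace n m q := by
  ext v
  rw [antisymmetricSubspace, Module.End.mem_eigenspace_iff, LinearMap.mem_range]
  simp only [Matrix.toLin'_apply]
  constructor
  · rintro ⟨w, rfl⟩
    rw [Matrix.mulVec_mulVec, braidingX_mul_projMinus n m q hq, Matrix.neg_mulVec, neg_one_smul]
  · intro hv
    refine ⟨v, ?_⟩
    rw [projMinus_mulVec_of_eigen n m q _ v hv, inv_mul_cancel₀, one_smul]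
    have h1 : (-1 - q ^ 2) ≠ 0 := fun h => hq2 (by linear_combination -h)
    have h2 : (-1 - (q ^ 2)⁻¹) ≠ 0 := by
      intro h
      have : (q ^ 2) * (q ^ 2)⁻¹ = 1 := mul_inv_cancel₀ (pow_ne_zero 2 hq)
      exact hq2 (by linear_combination (-q ^ 2) * h - this)
    exact mul_ne_zero h1 h2

theorem projMinus_isIdempotentElem (n m : ℕ) (q : ℂ) (hq : q ≠ 0) (hq2 : q ^ 2 ≠ -1) :
    IsIdempotentElem (projMinus n m q) := by
  have h1 : (-1 - q ^ 2) ≠ 0 := fun h => hq2 (by linear_combination -h)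
  have h2 : (-1 - (q ^ 2)⁻¹) ≠ 0 := by
    intro h
    have : (q ^ 2) * (q ^ 2)⁻¹ = 1 := mul_inv_cancel₀ (pow_ne_zero 2 hq)
    exact hq2 (by linear_combination (-q ^ 2) * h - this)
  have h := braidingX_mul_projMinus n m q hq
  have h' : ∀ c : ℂ, (braidingX n m q - c • 1) * projMinus n m q = (-1 - c) • projMinus n m q := by
    intro c
    rw [sub_mul, h, smul_mul_assoc, one_mul]
    module
  have h3 : projMinus n m q * projMinus n m q = ((-1 - q ^ 2) * (-1 - (q ^ 2)⁻¹))⁻¹ •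
      ((braidingX n m q - (q ^ 2) • 1) * ((braidingX n m q - ((q ^ 2)⁻¹) • 1) *
        projMinus n m q)) := by
    rw [← mul_assoc, ← smul_mul_assoc, ← projMinus]
  rw [IsIdempotentElem, h3, h', mul_smul_comm, h', smul_smul, smul_smul,
    mul_assoc, mul_comm (-1 - (q ^ 2)⁻¹), inv_mul_cancel₀ (mul_ne_zero h1 h2), one_smul]

theorem ker_projMinus (n m : ℕ) (q : ℂ) (hq : q ≠ 0) (hq4 : q ^ 4 ≠ 1) :
    LinearMap.ker (Matrix.toLin' (projMinus n m q)) = symmetricSubspace n m q := by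
  have h0 : (q ^ 2) * (q ^ 2)⁻¹ = 1 := mul_inv_cancel₀ (pow_ne_zero 2 hq)
  have h1 : (-1 - q ^ 2) ≠ 0 := fun h => hq4 (by linear_combination (1 - q ^ 2) * h)
  have h2 : (-1 - (q ^ 2)⁻¹) ≠ 0 := by
    intro h
    exact h1 (by linear_combination (q ^ 2) * h + h0)
  have h3 : q ^ 2 - (q ^ 2)⁻¹ ≠ 0 := by
    intro h
    exact hq4 (by linear_combination (q ^ 2) * h + h0)
  rw [symmetricSubspace]
  apply le_antisymm
  · intro v hv
    rw [LinearMap.mem_ker, Matrix.toLin'_apply, projMinus, Matrix.smul_mulVec,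
      smul_eq_zero_iff_right (inv_ne_zero (mul_ne_zero h1 h2)), ← Matrix.mulVec_mulVec] at hv
    simp only [Matrix.sub_mulVec, Matrix.smul_mulVec, Matrix.one_mulVec, Matrix.mulVec_sub,
      Matrix.mulVec_smul] at hv
    have e : v = (q ^ 2 - (q ^ 2)⁻¹)⁻¹ • ((braidingX n m q).mulVec v - (q ^ 2)⁻¹ • v)
        + (q ^ 2 - (q ^ 2)⁻¹)⁻¹ • (q ^ 2 • v - (braidingX n m q).mulVec v) := by
      rw [← smul_add, sub_add_sub_comm, add_comm, add_sub_add_right_eq_sub, ← sub_smul, smul_smul,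
        inv_mul_cancel₀ h3, one_smul]
    rw [e]
    refine Submodule.add_mem_sup (Submodule.smul_mem _ _ ?_) (Submodule.smul_mem _ _ ?_)
    · rw [Module.End.mem_eigenspace_iff, Matrix.toLin'_apply, Matrix.mulVec_sub,
        Matrix.mulVec_smul, ← sub_eq_zero, ← hv]
      module
    · rw [Module.End.mem_eigenspace_iff, Matrix.toLin'_apply, Matrix.mulVec_sub,
        Matrix.mulVec_smul, ← sub_eq_zero, ← neg_zero, ← hv]
      module
  · refine sup_le ?_ ?_ <;> intro v hv <;>
      rw [Module.End.mem_eigenspace_iff, Matrix.toLin'_apply] at hv <;>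
      rw [LinearMap.mem_ker, Matrix.toLin'_apply, projMinus_mulVec_of_eigen n m q _ v hv] <;>
      simp

/-! The algebra `O(M_q(X̄))` -/

/-- Labels of the entries `u_{x,y}` of the variable matrix `u`, also written
`z_{i₁i₂,k₁k₂}` for `x = (i₁, i₂)`, `y = (k₁, k₂)`. -/
abbrev Gen (n m : ℕ) := Idx n m × Idx n m

/-- The free algebra `ℂ⟨u⟩` over the entries of `u`. -/
abbrev Free (n m : ℕ) := FreeAlgebra ℂ (Gen n m)

/-- The variable matrix `u`, with entries in the free algebra. -/
def genMatrix (n m : ℕ) : Matrix (Idx n m) (Idx n m) (Free n m) :=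
  Matrix.of fun x y => FreeAlgebra.ι ℂ (x, y)

/-- The left hand side `P_+ (u ⊗ u)` of the defining relations. -/
def relLeft (n m : ℕ) (q : ℂ) : Matrix (Idx n m × Idx n m) (Idx n m × Idx n m) (Free n m) :=
  (projPlus n m q).map (algebraMap ℂ (Free n m)) * (genMatrix n m ⊗ₖ genMatrix n m)

/-- The right hand side `(u ⊗ u) P_+` of the defining relations. -/
def relRight (n m : ℕ) (q : ℂ) : Matrix (Idx n m × Idx n m) (Idx n m × Idx n m) (Free n m) :=
  (genMatrix n m ⊗ₖ genMatrix n m) * (projPlus n m q).map (algebraMap ℂ (Free n m))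

/-- The defining relations, entry by entry. -/
def Rel (n m : ℕ) (q : ℂ) (a b : Free n m) : Prop :=
  ∃ r c, a = relLeft n m q r c ∧ b = relRight n m q r c

/-- The coordinate algebra `O(M_q(X̄)) = ℂ⟨u⟩ / ⟨P_+ (u ⊗ u) = (u ⊗ u) P_+⟩`. -/
abbrev CoordAlg (n m : ℕ) (q : ℂ) := RingQuot (Rel n m q)

/-- The quotient map `ℂ⟨u⟩ → O(M_q(X̄))`. -/
def toCoord (n m : ℕ) (q : ℂ) : Free n m →ₐ[ℂ] CoordAlg n m q :=
  RingQuot.mkAlgHom ℂ (Rel n m q)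

/-- The degree `d` component of `O(M_q(X̄))`: the span of the products of `d` generators (the
`d`-th power, for the product of subspaces, of the span of the generators). -/
def component (n m : ℕ) (q : ℂ) (d : ℕ) : Submodule ℂ (CoordAlg n m q) :=
  Submodule.span ℂ (Set.range fun A : Gen n m => toCoord n m q (FreeAlgebra.ι ℂ A)) ^ d

/-- The Poincaré series `∑_d dim(O(M_q(X̄))_d) t^d`. -/
def poincareSeries (n m : ℕ) (q : ℂ) : PowerSeries ℕ :=
  PowerSeries.mk fun d => Module.finrank ℂ (component n m q d)

/-- The Poincaré series of the classical coordinate ring `O(M(X))`, the commutative polynomial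
ring in the entries of `u`. -/
def classicalPoincareSeries (n m : ℕ) : PowerSeries ℕ :=
  PowerSeries.mk fun d => Module.finrank ℂ (MvPolynomial.homogeneousSubmodule (Gen n m) ℂ d)

/-! The reduction system -/

/-- The lexicographic order of the variables `z_{i₁i₂,k₁k₂}`, through the label
`(i₁, i₂, k₁, k₂)`. -/
def lexKey {n m : ℕ} (A : Gen n m) : Fin n ×ₗ Fin m ×ₗ Fin n ×ₗ Fin m :=
  toLex (A.1.1, toLex (A.1.2, toLex (A.2.1, A.2.2)))

/-- The monomial of a word in the variables. -/
def monomial {n m : ℕ} (w : List (Gen n m)) : Free n m :=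
  (w.map (FreeAlgebra.ι ℂ)).prod

/-- A word `A₁ A₂ ⋯ A_d` is standard if `A₁ ⪰ A₂ ⪰ ⋯ ⪰ A_d`. -/
def IsStandard {n m : ℕ} (w : List (Gen n m)) : Prop :=
  w.Pairwise fun A B => lexKey B ≤ lexKey A

/-- The span of the standard monomials of degree `d` in the free algebra. -/
def standardSpan (n m d : ℕ) : Submodule ℂ (Free n m) :=
  Submodule.span ℂ {f | ∃ w : List (Gen n m), w.length = d ∧ IsStandard w ∧ f = monomial w}

/-- The span, in degree 2 of the free algebra, of the defining relations. -/
def relSpan (n m : ℕ) (q : ℂ) : Submodule ℂ (Free n m) :=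
  Submodule.span ℂ {f | ∃ r c, f = relLeft n m q r c - relRight n m q r c}

/-- `z_A z_B → f` is a rule of the reduction system: `z_A z_B` is not standard, `f` is a linear
combination of standard monomials of degree 2, and `z_A z_B = f` is a linear combination of the
defining relations. -/
def IsRule {n m : ℕ} (q : ℂ) (A B : Gen n m) (f : Free n m) : Prop :=
  ¬ IsStandard [A, B] ∧ f ∈ standardSpan n m 2 ∧ monomial [A, B] - f ∈ relSpan n m q

/-- An elementary reduction: the linear endomorphism of the free algebra that applies a rule
`z_A z_B → f` at one place of one monomial, and fixes all the other monomials. -/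
def IsReduction {n m : ℕ} (q : ℂ) (ρ : Free n m →ₗ[ℂ] Free n m) : Prop :=
  ∃ (l r : List (Gen n m)) (A B : Gen n m) (f : Free n m), IsRule q A B f ∧
    ρ (monomial (l ++ [A, B] ++ r)) = monomial l * f * monomial r ∧
    ∀ w, w ≠ l ++ [A, B] ++ r → ρ (monomial w) = monomial w

/-- `g` can be turned into `h` by a finite sequence of elementary reductions. -/
def Reduces {n m : ℕ} (q : ℂ) : Free n m → Free n m → Prop :=
  Relation.ReflTransGen fun g h => ∃ ρ, IsReduction q ρ ∧ h = ρ g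

/-- The diamond property: a monomial of degree 3, reduced in any way to a combination of standard
monomials, always leads to the same result. -/
def DiamondProperty (n m : ℕ) (q : ℂ) : Prop :=
  ∀ (A B C : Gen n m) (g h : Free n m),
    Reduces q (monomial [A, B, C]) g → g ∈ standardSpan n m 3 →
    Reduces q (monomial [A, B, C]) h → h ∈ standardSpan n m 3 → g = h

/-- For `dim V = dim W = 2`, the label of `z_{i₁i₂,k₁k₂}`, the indices running over `0, 1`. -/
abbrev lab (i₁ i₂ k₁ k₂ : Fin 2) : Gen 2 2 := ((i₁, i₂), (k₁, k₂))

/-- The monomial `z_{11,11} z_{11,12} z_{12,21}` (indices `1, 2` are written `0, 1`). -/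
def startMonomial : Free 2 2 := monomial [lab 0 0 0 0, lab 0 0 0 1, lab 0 1 1 0]

/-- The first standard expression of `startMonomial`. -/
def firstExpr (q : ℂ) : Free 2 2 :=
  (q ^ 2 - 1) • monomial [lab 0 1 0 0, lab 0 0 1 0, lab 0 0 0 1]
  + ((q ^ 3 - q) / (1 + q ^ 2)) • monomial [lab 0 1 0 0, lab 0 0 1 1, lab 0 0 0 0]
  + ((q ^ 2 - 1) / (1 + q ^ 2)) • monomial [lab 0 1 0 1, lab 0 0 1 0, lab 0 0 0 0]
  + (2 * q ^ 2 / (1 + q ^ 2)) • monomial [lab 0 1 1 0, lab 0 0 0 1, lab 0 0 0 0]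
  + ((1 - q ^ 2) * q / (1 + q ^ 2)) • monomial [lab 0 1 1 1, lab 0 0 0 0, lab 0 0 0 0]

/-- The second standard expression of `startMonomial`. -/
def secondExpr (q : ℂ) : Free 2 2 :=
  ((q ^ 6 + q ^ 4 - 3 * q ^ 2 + 1) / (q ^ 2 * (1 + q ^ 2))) •
      monomial [lab 0 1 0 0, lab 0 0 1 0, lab 0 0 0 1]
  + ((2 * q ^ 3 - 2 * q) / (1 + q ^ 2) ^ 2) • monomial [lab 0 1 0 0, lab 0 0 1 1, lab 0 0 0 0]
  + ((4 * q ^ 2 + q ^ 4 - 1) / (1 + q ^ 2) ^ 2) •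
      monomial [lab 0 1 1 0, lab 0 0 0 1, lab 0 0 0 0]
  + ((2 * q ^ 2 - 2) / (1 + q ^ 2) ^ 2) •
      (monomial [lab 0 1 0 1, lab 0 0 1 0, lab 0 0 0 0]
        - q • monomial [lab 0 1 1 1, lab 0 0 0 0, lab 0 0 0 0])

end

end QMat

namespace QMat

noncomputable section

/-! ### Words in the free algebra -/

/-! Everything rests on replacing the braiding by an involution. The braiding of `V` has eigenvalues
among `q` and `-q⁻¹`; let `S` be the affine function of it with values `1` and `-1` there (`invol`).
On `X̄ ⊗ X̄` the product `S ⊗ S` (`involX`) is `1` where the two signs agree (eigenvalues `q²`,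
`q⁻²`) and `-1` where they differ (eigenvalue `-1`), so `P_+ = (1 + S ⊗ S) / 2` (`projPlus_eq`). The
defining relations then say that `u ⊗ u` commutes with one involution.

Dimension in degree 3. A functional on the cubic component is a matrix on the tensor cube of `X̄`
commuting with the involution in places 1, 2 and with that in places 2, 3 (`range_tripleValues`).
The dimension sought is thus that of the endomorphism algebra of a representation of the infinite
dihedral group, the free product of two groups of order 2. This representation is the tensor product
of those on the cubes of `V` and `W`. For a two-dimensional space the cube is four trivial lines
plus two copies of a two-dimensional representation `ρ`, in which the product of the involutions has
trace `2c`, `c = -(1 + q⁴) / (1 + q²)²`. Writing `c = cos θ`, `ρ ⊗ ρ` is the sum of the trivial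
representation, the determinant and a representation of angle `2θ`. The last is isomorphic to `ρ`
when `c = -1/2`, that is, when `q² = 1`; for other admissible `q` it is not. Hence the
multiplicities are 20, 16, 4, 4, with `20² + 16² + 4² + 4² = 688`, whereas at `q = 1` they are 20,
20, 4, with sum of squares 816. The proof reaches 688 through dimensions of spaces of intertwiners
between blocks (`finrank_intertwiners_block`, `sum_blockHomDim`), and 816 by counting commutative
monomials (`finrank_homogeneousSubmodule`), after identifying the algebra at `q = 1` with the
polynomial ring (`toPolynomial_bijective`).

Rules. Standard quadratic monomials span a complement of the relations. Both halves come from one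
vanishing statement, `eq_zero_of_intertwines`: a matrix commuting with the involution and zero at
standard places is zero (dually, spanning), and a matrix anticommuting with it and zero at
nonstandard places is zero (independence).

Failure of the diamond property. The overlap `z_{11,11} z_{11,12} z_{12,21}` is reduced with
explicit rules, starting once from the left pair and once from the right pair; the outcomes differ
in a coefficient unless `q² = 1`. -/

theorem monomial_nil {n m : ℕ} : monomial ([] : List (Gen n m)) = 1 := rfl

theorem monomial_append {n m : ℕ} (v w : List (Gen n m)) :
    monomial (v ++ w) = monomial v * monomial w := by
  simp [monomial]

theorem monomial_cons {n m : ℕ} (A : Gen n m) (w : List (Gen n m)) :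
    monomial (A :: w) = FreeAlgebra.ι ℂ A * monomial w := by
  simp [monomial]

/-- The monomials form a basis of the free algebra. -/
def wordBasis (n m : ℕ) : Module.Basis (List (Gen n m)) ℂ (Free n m) :=
  FreeAlgebra.basisFreeMonoid ℂ (Gen n m)

theorem wordBasis_apply {n m : ℕ} (w : List (Gen n m)) : wordBasis n m w = monomial w := by
  simp only [wordBasis, FreeAlgebra.basisFreeMonoid]
  change FreeAlgebra.equivMonoidAlgebraFreeMonoid.symm
    (MonoidAlgebra.single (FreeMonoid.ofList w) (1 : ℂ)) = _
  rw [AlgEquiv.symm_apply_eq]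
  induction w with
  | nil => rw [monomial_nil, map_one]; rfl
  | cons A w ih =>
    rw [monomial_cons, map_mul, ← ih, FreeMonoid.ofList_cons]
    simp [FreeAlgebra.equivMonoidAlgebraFreeMonoid, MonoidAlgebra.single_mul_single]

/-- The linear map with prescribed values on monomials. -/
def wordLift {n m : ℕ} {M : Type*} [AddCommGroup M] [Module ℂ M] (φ : List (Gen n m) → M) :
    Free n m →ₗ[ℂ] M :=
  (wordBasis n m).constr ℂ φ

@[simp]
theorem wordLift_monomial {n m : ℕ} {M : Type*} [AddCommGroup M] [Module ℂ M]
    (φ : List (Gen n m) → M) (w : List (Gen n m)) : wordLift φ (monomial w) = φ w := by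
  rw [wordLift, ← wordBasis_apply, Module.Basis.constr_basis]

theorem hom_ext_monomial {n m : ℕ} {M : Type*} [AddCommGroup M] [Module ℂ M]
    {f g : Free n m →ₗ[ℂ] M} (h : ∀ w, f (monomial w) = g (monomial w)) : f = g :=
  (wordBasis n m).ext fun w => by rw [wordBasis_apply, h]

/-! ### The defining relations -/

theorem relLeft_apply {n m : ℕ} (q : ℂ) (r c : Idx n m × Idx n m) :
    relLeft n m q r c =
      ∑ k, projPlus n m q r k • monomial [(k.1, c.1), (k.2, c.2)] := by
  rw [relLeft, Matrix.mul_apply]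
  refine Finset.sum_congr rfl fun k _ => ?_
  simp [monomial, genMatrix, Algebra.smul_def]

theorem relRight_apply {n m : ℕ} (q : ℂ) (r c : Idx n m × Idx n m) :
    relRight n m q r c =
      ∑ k, projPlus n m q k c • monomial [(r.1, k.1), (r.2, k.2)] := by
  rw [relRight, Matrix.mul_apply]
  refine Finset.sum_congr rfl fun k _ => ?_
  simp [monomial, genMatrix, Algebra.smul_def, Algebra.commutes]

theorem toCoord_relLeft {n m : ℕ} (q : ℂ) (r c : Idx n m × Idx n m) :
    toCoord n m q (relLeft n m q r c) = toCoord n m q (relRight n m q r c) :=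
  RingQuot.mkAlgHom_rel ℂ ⟨r, c, rfl, rfl⟩

theorem toCoord_surjective (n m : ℕ) (q : ℂ) : Function.Surjective (toCoord n m q) :=
  RingQuot.mkAlgHom_surjective ℂ _

/-- The ring congruence of all pairs that a functional does not distinguish, even after
multiplication from both sides. -/
def functionalCon {n m : ℕ} (Φ : Free n m →ₗ[ℂ] ℂ) : RingCon (Free n m) where
  r x y := ∀ a b, Φ (a * x * b) = Φ (a * y * b)
  iseqv := ⟨fun _ _ _ => rfl, fun h a b => (h a b).symm, fun h k a b => (h a b).trans (k a b)⟩
  add' h k a b := by simp only [mul_add, add_mul, map_add, h a b, k a b]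
  mul' {w x y z} h k a b := by
    have h1 := h a (y * b)
    have h2 := k (a * x) b
    simp only [mul_assoc] at h1 h2 ⊢
    exact h1.trans h2

/-- A functional that vanishes on the products of relations with monomials descends to
`O(M_q(X̄))`. -/
theorem exists_functional {n m : ℕ} (q : ℂ) (Φ : Free n m →ₗ[ℂ] ℂ)
    (h : ∀ v w r c, Φ (monomial v * relLeft n m q r c * monomial w) =
      Φ (monomial v * relRight n m q r c * monomial w)) :
    ∃ Ψ : CoordAlg n m q →ₗ[ℂ] ℂ, ∀ x, Ψ (toCoord n m q x) = Φ x := by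
  -- Both outer factors are extended linearly from monomials to arbitrary elements, first the right
  -- one and then the left one.
  have h1 : ∀ v r c b, Φ (monomial v * relLeft n m q r c * b) =
      Φ (monomial v * relRight n m q r c * b) := fun v r c b =>
    LinearMap.congr_fun (hom_ext_monomial
      (f := Φ ∘ₗ LinearMap.mulLeft ℂ (monomial v * relLeft n m q r c))
      (g := Φ ∘ₗ LinearMap.mulLeft ℂ (monomial v * relRight n m q r c)) fun w => h v w r c) b
  have h2 : ∀ a r c b, Φ (a * relLeft n m q r c * b) = Φ (a * relRight n m q r c * b) := by
    intro a r c b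
    have := LinearMap.congr_fun (hom_ext_monomial
      (f := Φ ∘ₗ LinearMap.mulRight ℂ (relLeft n m q r c * b))
      (g := Φ ∘ₗ LinearMap.mulRight ℂ (relRight n m q r c * b)) fun v => by
        simpa [mul_assoc] using h1 v r c b) a
    simpa [mul_assoc] using this
  have h3 : ∀ ⦃x y⦄, Rel n m q x y → (functionalCon Φ).mk' x = (functionalCon Φ).mk' y := by
    rintro x y ⟨r, c, rfl, rfl⟩
    exact (RingCon.eq _).2 fun a b => h2 a r c b
  have h4 : ∀ x y, toCoord n m q x = toCoord n m q y → Φ x = Φ y := by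
    intro x y hxy
    have hxy' : RingQuot.mkRingHom (Rel n m q) x = RingQuot.mkRingHom (Rel n m q) y := by
      rw [← RingQuot.mkAlgHom_coe ℂ]; exact hxy
    have := congrArg (RingQuot.lift ⟨(functionalCon Φ).mk', h3⟩) hxy'
    rw [RingQuot.lift_mkRingHom_apply, RingQuot.lift_mkRingHom_apply] at this
    simpa using (RingCon.eq _).1 this 1 1
  -- By `h4` the functional is constant on fibres of the quotient map, so composing it with any
  -- linear section gives the descended functional.
  obtain ⟨s, hs⟩ := (toCoord n m q).toLinearMap.exists_rightInverse_of_surjective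
    (LinearMap.range_eq_top.2 (toCoord_surjective n m q))
  exact ⟨Φ ∘ₗ s, fun x => h4 _ _ (LinearMap.congr_fun hs (toCoord n m q x))⟩

theorem component_eq_span {n m : ℕ} (q : ℂ) (d : ℕ) :
    component n m q d = Submodule.span ℂ
      {x | ∃ w : List (Gen n m), w.length = d ∧ x = toCoord n m q (monomial w)} := by
  induction d with
  | zero =>
    rw [component, pow_zero, Submodule.one_eq_span]
    congr 1
    ext x
    simp [monomial_nil]
  | succ d ih =>
    rw [component, pow_succ', ← component, ih, Submodule.span_mul_span]
    congr 1
    ext x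
    rw [Set.mem_mul]
    constructor
    · rintro ⟨-, ⟨A, rfl⟩, -, ⟨w, hw, rfl⟩, rfl⟩
      exact ⟨A :: w, by simp [hw], by simp [monomial_cons]⟩
    · rintro ⟨w, hw, rfl⟩
      obtain _ | ⟨A, w⟩ := w
      · simp at hw
      · exact ⟨_, ⟨A, rfl⟩, _, ⟨w, by simpa using hw, rfl⟩, by simp [monomial_cons]⟩

/-! ### The braiding as a product of involutions -/

/-- The involution with the same eigenspaces as the braiding. -/
def invol (n : ℕ) (q : ℂ) : Matrix (Fin n × Fin n) (Fin n × Fin n) ℂ :=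
  (q + q⁻¹)⁻¹ • ((2 : ℂ) • braiding n q - (q - q⁻¹) • 1)

/-- The involution of `X̄ ⊗ X̄` that is `1` on the symmetric and `-1` on the antisymmetric
subspace. -/
def involX (n m : ℕ) (q : ℂ) : Matrix (Idx n m × Idx n m) (Idx n m × Idx n m) ℂ :=
  (invol n q ⊗ₖ invol m q).submatrix
    (Equiv.prodProdProdComm (Fin n) (Fin m) (Fin n) (Fin m))
    (Equiv.prodProdProdComm (Fin n) (Fin m) (Fin n) (Fin m))

theorem add_inv_ne_zero {q : ℂ} (hq : q ≠ 0) (hq2 : q ^ 2 ≠ -1) : q + q⁻¹ ≠ 0 := by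
  intro h
  apply hq2
  field_simp at h
  linear_combination h

/-- The Hecke relation, after completing the square, says that `2 R̂ - (q - q⁻¹)` has square `(q +
q⁻¹)²`. -/
theorem invol_mul_self (n : ℕ) {q : ℂ} (hq : q ≠ 0) (hq2 : q ^ 2 ≠ -1) :
    invol n q * invol n q = 1 := by
  have hb := add_inv_ne_zero hq hq2
  have h := braiding_mul_self n q hq
  have h1 : q * q⁻¹ = 1 := mul_inv_cancel₀ hq
  have e : ((2 : ℂ) • braiding n q - (q - q⁻¹) • 1) * ((2 : ℂ) • braiding n q - (q - q⁻¹) • 1)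
      = (q + q⁻¹) ^ 2 • (1 : Matrix (Fin n × Fin n) (Fin n × Fin n) ℂ) := by
    simp only [sub_mul, mul_sub, smul_mul_assoc, mul_smul_comm, one_mul, mul_one, h]
    match_scalars <;> first | ring1 | linear_combination (-4) * h1
  rw [invol, smul_mul_smul_comm, e, smul_smul]
  rw [pow_two, mul_mul_mul_comm, inv_mul_cancel₀ hb, one_mul, one_smul]

theorem involX_mul_self (n m : ℕ) {q : ℂ} (hq : q ≠ 0) (hq2 : q ^ 2 ≠ -1) :
    involX n m q * involX n m q = 1 := by
  rw [involX, Matrix.submatrix_mul_equiv, ← Matrix.mul_kronecker_mul, invol_mul_self n hq hq2,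
    invol_mul_self m hq hq2, Matrix.one_kronecker_one, Matrix.submatrix_one_equiv]

/-- The product of two signs is `-1` exactly on the mixed eigenspaces, where the braiding of `X̄` is
`q · (-q⁻¹) = -1`. The proof checks the resulting polynomial identity in the two Hecke generators,
so it also covers `q = 1`, where the other two eigenvalues coincide. -/
theorem projPlus_eq (n m : ℕ) {q : ℂ} (hq : q ≠ 0) (hq2 : q ^ 2 ≠ -1) :
    projPlus n m q = (2 : ℂ)⁻¹ • (1 + involX n m q) := by
  have hb := add_inv_ne_zero hq hq2
  have h1 : q * q⁻¹ = 1 := mul_inv_cancel₀ hq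
  have hV := braiding_mul_self n q hq
  have hW := braiding_mul_self m q hq
  have hs : (q ^ 2) + (q ^ 2)⁻¹ = (q - q⁻¹) ^ 2 + 2 := by field_simp; ring
  have h2 : (q ^ 2) * (q ^ 2)⁻¹ = 1 := mul_inv_cancel₀ (pow_ne_zero 2 hq)
  have hp : (-1 - q ^ 2) * (-1 - (q ^ 2)⁻¹) = (q + q⁻¹) ^ 2 := by
    linear_combination hs + h2 - 4 * h1
  set a := braiding n q
  set b := braiding m q
  set e := Equiv.prodProdProdComm (Fin n) (Fin m) (Fin n) (Fin m)
  set R : Matrix _ _ ℂ := a ⊗ₖ b with hR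
  set h : ℂ := q - q⁻¹ with hh
  have hX : braidingX n m q = Matrix.reindexAlgEquiv ℂ ℂ e.symm R := rfl
  have hI : involX n m q = Matrix.reindexAlgEquiv ℂ ℂ e.symm (invol n q ⊗ₖ invol m q) := rfl
  have hRR : R * R = h ^ 2 • R + h • (a ⊗ₖ (1 : Matrix (Fin m × Fin m) (Fin m × Fin m) ℂ))
      + h • ((1 : Matrix (Fin n × Fin n) (Fin n × Fin n) ℂ) ⊗ₖ b) + 1 := by
    rw [hR, ← Matrix.mul_kronecker_mul, hV, hW]
    simp only [Matrix.add_kronecker, Matrix.kronecker_add, Matrix.smul_kronecker,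
      Matrix.kronecker_smul, Matrix.one_kronecker_one]
    module
  have hq2' : (R - (q ^ 2) • 1) * (R - ((q ^ 2)⁻¹) • 1) = R * R - (h ^ 2 + 2) • R + 1 := by
    rw [← hs]
    generalize (q ^ 2)⁻¹ = t at h2 ⊢
    simp only [sub_mul, mul_sub, smul_mul_assoc, mul_smul_comm, one_mul, mul_one]
    match_scalars <;> first | ring1 | linear_combination h2
  have hI' : (invol n q ⊗ₖ invol m q) = ((q + q⁻¹) ^ 2)⁻¹ • ((4 : ℂ) • R -
      (2 * h) • (a ⊗ₖ (1 : Matrix (Fin m × Fin m) (Fin m × Fin m) ℂ)) -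
      (2 * h) • ((1 : Matrix (Fin n × Fin n) (Fin n × Fin n) ℂ) ⊗ₖ b) + h ^ 2 • 1) := by
    simp only [invol, sub_eq_add_neg, ← neg_smul, Matrix.add_kronecker, Matrix.kronecker_add,
      Matrix.smul_kronecker, Matrix.kronecker_smul, Matrix.one_kronecker_one, hR, ← neg_smul]
    rw [pow_two, mul_inv]
    module
  have key : ((q + q⁻¹) ^ 2)⁻¹ • ((R - (q ^ 2) • 1) * (R - ((q ^ 2)⁻¹) • 1)) =
      (2 : ℂ)⁻¹ • (1 - invol n q ⊗ₖ invol m q) := by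
    rw [hq2', hRR, hI']
    have h3 : (q + q⁻¹) ^ 2 = h ^ 2 + 4 := by rw [hh]; linear_combination 4 * h1
    have h4 : h ^ 2 + 4 ≠ 0 := by rw [← h3]; exact pow_ne_zero 2 hb
    rw [h3]
    match_scalars <;> field_simp <;> ring
  rw [projPlus, projMinus, hp, hX, hI]
  have := congrArg (Matrix.reindexAlgEquiv ℂ ℂ e.symm) key
  simp only [map_mul, map_sub, map_smul, map_one] at this
  rw [this]
  module

/-! ### Functionals on quadratic and cubic monomials as matrices -/

/-- The word `u_{r₁c₁} u_{r₂c₂}`, an entry of `u ⊗ u`. -/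
def pairWord {n m : ℕ} (r c : Idx n m × Idx n m) : List (Gen n m) :=
  [(r.1, c.1), (r.2, c.2)]

/-- The word `u_{r₁c₁} u_{r₂c₂} u_{r₃c₃}`, an entry of `u ⊗ u ⊗ u`. -/
def tripleWord {n m : ℕ} (r c : Idx n m × Idx n m × Idx n m) : List (Gen n m) :=
  [(r.1, c.1), (r.2.1, c.2.1), (r.2.2, c.2.2)]

/-- The identity part of `P_+ = (1 + S) / 2` commutes with everything, so the relations only test
commutation with the involution. -/
theorem map_relLeft_eq_iff {n m : ℕ} {q : ℂ} (hq : q ≠ 0) (hq2 : q ^ 2 ≠ -1)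
    (Φ : Free n m →ₗ[ℂ] ℂ) :
    (∀ r c, Φ (relLeft n m q r c) = Φ (relRight n m q r c)) ↔
      involX n m q * Matrix.of (fun r c => Φ (monomial (pairWord r c))) =
        Matrix.of (fun r c => Φ (monomial (pairWord r c))) * involX n m q := by
  set φ : Matrix _ _ ℂ := Matrix.of (fun r c => Φ (monomial (pairWord r c))) with hφ
  have hL : ∀ r c, Φ (relLeft n m q r c) = (projPlus n m q * φ) r c := by
    intro r c
    simp [relLeft_apply, Matrix.mul_apply, hφ, pairWord]
  have hR : ∀ r c, Φ (relRight n m q r c) = (φ * projPlus n m q) r c := by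
    intro r c
    simp [relRight_apply, Matrix.mul_apply, hφ, pairWord, mul_comm]
  simp only [hL, hR]
  rw [Matrix.ext_iff, projPlus_eq n m hq hq2, smul_mul_assoc, mul_smul_comm,
    smul_right_inj (inv_ne_zero two_ne_zero), add_mul, mul_add, one_mul, mul_one, add_right_inj]

section Amplification

variable {α : Type*} [DecidableEq α]

/-- The operator `A ⊗ 1` on a threefold tensor power. -/
def ampL (A : Matrix (α × α) (α × α) ℂ) : Matrix (α × α × α) (α × α × α) ℂ :=
  Matrix.of fun r c => if r.2.2 = c.2.2 then A (r.1, r.2.1) (c.1, c.2.1) else 0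

/-- The operator `1 ⊗ A` on a threefold tensor power. -/
def ampR (A : Matrix (α × α) (α × α) ℂ) : Matrix (α × α × α) (α × α × α) ℂ :=
  Matrix.of fun r c => if r.1 = c.1 then A r.2 c.2 else 0

variable [Fintype α] {κ : Type*}

theorem ampL_mul_apply (A : Matrix (α × α) (α × α) ℂ) (X : Matrix (α × α × α) κ ℂ)
    (r : α × α × α) (c : κ) :
    (ampL A * X) r c = ∑ k, A (r.1, r.2.1) k * X (k.1, k.2, r.2.2) c := by
  simp [ampL, Matrix.mul_apply, Fintype.sum_prod_type]

theorem mul_ampL_apply (A : Matrix (α × α) (α × α) ℂ) (X : Matrix κ (α × α × α) ℂ)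
    (r : κ) (c : α × α × α) :
    (X * ampL A) r c = ∑ k, X r (k.1, k.2, c.2.2) * A k (c.1, c.2.1) := by
  simp [ampL, Matrix.mul_apply, Fintype.sum_prod_type]

theorem ampR_mul_apply (A : Matrix (α × α) (α × α) ℂ) (X : Matrix (α × α × α) κ ℂ)
    (r : α × α × α) (c : κ) :
    (ampR A * X) r c = ∑ k, A r.2 k * X (r.1, k) c := by
  simp [ampR, Matrix.mul_apply, Fintype.sum_prod_type]

theorem mul_ampR_apply (A : Matrix (α × α) (α × α) ℂ) (X : Matrix κ (α × α × α) ℂ)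
    (r : κ) (c : α × α × α) :
    (X * ampR A) r c = ∑ k, X r (c.1, k) * A k c.2 := by
  simp [ampR, Matrix.mul_apply, Fintype.sum_prod_type]

end Amplification

/-- The matrices that intertwine two pairs of square matrices. -/
def intertwiners {ι κ : Type*} [Fintype ι] [Fintype κ] (A B : Matrix ι ι ℂ)
    (A' B' : Matrix κ κ ℂ) : Submodule ℂ (Matrix ι κ ℂ) where
  carrier := {X | A * X = X * A' ∧ B * X = X * B'}
  add_mem' hX hY := by
    simp only [Set.mem_ofPred_eq, Matrix.mul_add, Matrix.add_mul] at *
    rw [hX.1, hX.2, hY.1, hY.2]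
    exact ⟨rfl, rfl⟩
  zero_mem' := by simp
  smul_mem' a X hX := by
    simp only [Set.mem_ofPred_eq, Matrix.mul_smul, Matrix.smul_mul] at *
    rw [hX.1, hX.2]
    exact ⟨rfl, rfl⟩

theorem mem_intertwiners {ι κ : Type*} [Fintype ι] [Fintype κ] {A B : Matrix ι ι ℂ}
    {A' B' : Matrix κ κ ℂ} {X : Matrix ι κ ℂ} :
    X ∈ intertwiners A B A' B' ↔ A * X = X * A' ∧ B * X = X * B' := Iff.rfl

/-- The values of a functional at the entries of `u ⊗ u ⊗ u`. -/
def tripleValues (n m : ℕ) (q : ℂ) : Module.Dual ℂ (component n m q 3) →ₗ[ℂ]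
    Matrix (Idx n m × Idx n m × Idx n m) (Idx n m × Idx n m × Idx n m) ℂ where
  toFun ψ := Matrix.of fun r c => ψ ⟨toCoord n m q (monomial (tripleWord r c)), by
    rw [component_eq_span]; exact Submodule.subset_span ⟨_, rfl, rfl⟩⟩
  map_add' _ _ := rfl
  map_smul' _ _ := rfl

theorem tripleValues_injective (n m : ℕ) (q : ℂ) :
    Function.Injective (tripleValues n m q) := by
  rw [← LinearMap.ker_eq_bot, LinearMap.ker_eq_bot']
  intro ψ hψ
  obtain ⟨Ψ, hΨ⟩ := LinearMap.exists_extend ψ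
  have h : component n m q 3 ≤ LinearMap.ker Ψ := by
    rw [component_eq_span, Submodule.span_le]
    rintro x ⟨w, hw, rfl⟩
    obtain ⟨A, B, C, rfl⟩ := List.length_eq_three.1 hw
    have h1 := congrFun (congrFun hψ (A.1, B.1, C.1)) (A.2, B.2, C.2)
    rw [← hΨ] at h1
    exact h1
  ext x
  rw [← hΨ]
  exact h x.2

/-- In degree 3 the ideal is spanned by relations times one variable, on the right or on the left.
Killing the first kind is commutation with the involution in places 1, 2; killing the second is
commutation in places 2, 3. -/
theorem range_tripleValues (n m : ℕ) {q : ℂ} (hq : q ≠ 0) (hq2 : q ^ 2 ≠ -1) :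
    LinearMap.range (tripleValues n m q) =
      intertwiners (ampL (involX n m q)) (ampR (involX n m q))
        (ampL (involX n m q)) (ampR (involX n m q)) := by
  apply le_antisymm
  · rintro - ⟨ψ, rfl⟩
    obtain ⟨Ψ, hΨ⟩ := LinearMap.exists_extend ψ
    have hval : ∀ r c, tripleValues n m q ψ r c = Ψ (toCoord n m q (monomial (tripleWord r c))) :=
      fun r c => by rw [← hΨ]; rfl
    have key : ∀ v w : Free n m, ∀ r c : Idx n m × Idx n m,
        ∑ k, involX n m q r k * Ψ (toCoord n m q (v * monomial (pairWord k c) * w)) =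
        ∑ k, Ψ (toCoord n m q (v * monomial (pairWord r k) * w)) * involX n m q k c := by
      intro v w r c
      have h := (map_relLeft_eq_iff (n := n) (m := m) hq hq2
        (Ψ ∘ₗ (toCoord n m q).toLinearMap ∘ₗ LinearMap.mulRight ℂ w ∘ₗ LinearMap.mulLeft ℂ v)).1
        (fun r c => by simp [toCoord_relLeft])
      simpa [Matrix.mul_apply] using congrFun (congrFun h r) c
    refine ⟨?_, ?_⟩
    · ext r c
      rw [ampL_mul_apply, mul_ampL_apply]
      simp only [hval]
      simpa [monomial, pairWord, tripleWord, mul_assoc] using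
        key 1 (monomial [(r.2.2, c.2.2)]) (r.1, r.2.1) (c.1, c.2.1)
    · ext r c
      rw [ampR_mul_apply, mul_ampR_apply]
      simp only [hval]
      simpa [monomial, pairWord, tripleWord, mul_assoc] using
        key (monomial [(r.1, c.1)]) 1 r.2 c.2
  · rintro φ ⟨h1, h2⟩
    -- Extending by zero outside degree 3 makes the conditions on `v · relation · w` trivial unless
    -- `v` and `w` have total length 1.
    let Φ : Free n m →ₗ[ℂ] ℂ := wordLift fun w => match w with
      | [A, B, C] => φ (A.1, B.1, C.1) (A.2, B.2, C.2)
      | _ => 0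
    obtain ⟨Ψ, hΨ⟩ := exists_functional q Φ (by
      intro v w
      refine (map_relLeft_eq_iff (n := n) (m := m) hq hq2
        (Φ ∘ₗ LinearMap.mulRight ℂ (monomial w) ∘ₗ LinearMap.mulLeft ℂ (monomial v))).2 ?_
      ext r c
      simp only [Matrix.mul_apply, Matrix.of_apply, LinearMap.comp_apply,
        LinearMap.mulLeft_apply, LinearMap.mulRight_apply, ← monomial_append, Φ,
        wordLift_monomial, pairWord]
      rcases v with _ | ⟨A, _ | ⟨A', v⟩⟩
      · rcases w with _ | ⟨C, _ | ⟨C', w⟩⟩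
        · simp
        · have := congrFun (congrFun h1 (r.1, r.2, C.1)) (c.1, c.2, C.2)
          rw [ampL_mul_apply, mul_ampL_apply] at this
          simpa using this
        · simp
      · rcases w with _ | ⟨C, w⟩
        · have := congrFun (congrFun h2 (A.1, r)) (A.2, c)
          rw [ampR_mul_apply, mul_ampR_apply] at this
          simpa using this
        · simp
      · rcases v with _ | ⟨_, v⟩ <;> simp)
    refine ⟨Ψ ∘ₗ (component n m q 3).subtype, ?_⟩
    ext r c
    change Ψ (toCoord n m q (monomial (tripleWord r c))) = φ r c
    rw [hΨ]
    simp [Φ, tripleWord]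

/-- Turns the dimension of a quotient into the dimension of a commutant, a component and its dual
having the same dimension. -/
theorem finrank_component_three (n m : ℕ) {q : ℂ} (hq : q ≠ 0) (hq2 : q ^ 2 ≠ -1) :
    Module.finrank ℂ (component n m q 3) = Module.finrank ℂ
      (intertwiners (ampL (involX n m q)) (ampR (involX n m q))
        (ampL (involX n m q)) (ampR (involX n m q))) := by
  rw [← range_tripleValues n m hq hq2,
    LinearMap.finrank_range_of_inj (tripleValues_injective n m q)]
  exact (Subspace.dual_finrank_eq (K := ℂ) (V := component n m q 3)).symm

/-! ### Dimensions of spaces of intertwiners -/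

/-- Conjugate pairs of matrices have spaces of self-intertwiners of the same dimension. -/
theorem finrank_intertwiners_conj {ι κ : Type*} [Fintype ι] [Fintype κ] [DecidableEq ι]
    [DecidableEq κ] {A B : Matrix ι ι ℂ} {C D : Matrix κ κ ℂ} (T : Matrix ι κ ℂ)
    (T' : Matrix κ ι ℂ) (h1 : T * T' = 1) (h2 : T' * T = 1) (hA : A * T = T * C)
    (hB : B * T = T * D) :
    Module.finrank ℂ (intertwiners A B A B) = Module.finrank ℂ (intertwiners C D C D) := by
  -- The inverse matrix intertwines in the opposite direction; conjugation by `T` is then the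
  -- required isomorphism.
  have hA' : T' * A = C * T' := by
    rw [← Matrix.mul_one (T' * A), ← h1, Matrix.mul_assoc, ← Matrix.mul_assoc A, hA,
      ← Matrix.mul_assoc, ← Matrix.mul_assoc, h2, Matrix.one_mul]
  have hB' : T' * B = D * T' := by
    rw [← Matrix.mul_one (T' * B), ← h1, Matrix.mul_assoc, ← Matrix.mul_assoc B, hB,
      ← Matrix.mul_assoc, ← Matrix.mul_assoc, h2, Matrix.one_mul]
  refine LinearEquiv.finrank_eq
    { toFun := fun X => ⟨T' * X.1 * T, ?_, ?_⟩
      invFun := fun Y => ⟨T * Y.1 * T', ?_, ?_⟩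
      map_add' := fun X Y => Subtype.ext (by simp [Matrix.mul_add, Matrix.add_mul])
      map_smul' := fun a X => Subtype.ext (by simp)
      left_inv := fun X => Subtype.ext ?_
      right_inv := fun Y => Subtype.ext ?_ }
  · rw [← Matrix.mul_assoc, ← Matrix.mul_assoc, ← hA', Matrix.mul_assoc T', X.2.1]
    simp only [Matrix.mul_assoc, hA]
  · rw [← Matrix.mul_assoc, ← Matrix.mul_assoc, ← hB', Matrix.mul_assoc T', X.2.2]
    simp only [Matrix.mul_assoc, hB]
  · rw [← Matrix.mul_assoc, ← Matrix.mul_assoc, hA, Matrix.mul_assoc T, Y.2.1]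
    simp only [Matrix.mul_assoc, hA']
  · rw [← Matrix.mul_assoc, ← Matrix.mul_assoc, hB, Matrix.mul_assoc T, Y.2.2]
    simp only [Matrix.mul_assoc, hB']
  · change T * (T' * X.1 * T) * T' = X.1
    rw [Matrix.mul_assoc T', ← Matrix.mul_assoc T, h1, Matrix.one_mul, Matrix.mul_assoc, h1,
      Matrix.mul_one]
  · change T' * (T * Y.1 * T') * T = Y.1
    rw [Matrix.mul_assoc T, ← Matrix.mul_assoc T', h2, Matrix.one_mul, Matrix.mul_assoc, h2,
      Matrix.mul_one]

theorem finrank_intertwiners_reindex {ι κ : Type*} [Fintype ι] [Fintype κ] [DecidableEq ι]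
    [DecidableEq κ] (e : κ ≃ ι) (A B : Matrix ι ι ℂ) :
    Module.finrank ℂ (intertwiners (A.submatrix e e) (B.submatrix e e) (A.submatrix e e)
      (B.submatrix e e)) = Module.finrank ℂ (intertwiners A B A B) := by
  have h : ∀ M : Matrix ι ι ℂ, M.submatrix e e * (1 : Matrix ι ι ℂ).submatrix e id =
      (1 : Matrix ι ι ℂ).submatrix e id * M := by
    intro M
    rw [Matrix.submatrix_mul_equiv, Matrix.mul_one]
    ext i j
    simp [Matrix.mul_apply, Matrix.one_apply]
  refine finrank_intertwiners_conj ((1 : Matrix ι ι ℂ).submatrix e id)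
    ((1 : Matrix ι ι ℂ).submatrix id e) ?_ ?_ (h A) (h B)
  · ext i j
    simp [Matrix.mul_apply, Matrix.one_apply]
  · rw [Matrix.submatrix_mul_equiv, Matrix.mul_one, Matrix.submatrix_id_id]

theorem blockDiagonal'_mul_apply {I : Type*} [Fintype I] [DecidableEq I] {J : I → Type*}
    [∀ a, Fintype (J a)] {κ : Type*} (ρ : ∀ a, Matrix (J a) (J a) ℂ) (X : Matrix (Σ a, J a) κ ℂ)
    (a : I) (i : J a) (k : κ) :
    (Matrix.blockDiagonal' ρ * X) ⟨a, i⟩ k = ∑ j, ρ a i j * X ⟨a, j⟩ k := by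
  rw [Matrix.mul_apply, Fintype.sum_sigma, Finset.sum_eq_single a]
  · simp [Matrix.blockDiagonal'_apply_eq]
  · intro b _ hb
    simp [Matrix.blockDiagonal'_apply_ne _ _ _ hb.symm]
  · simp

theorem mul_blockDiagonal'_apply {I : Type*} [Fintype I] [DecidableEq I] {J : I → Type*}
    [∀ a, Fintype (J a)] {κ : Type*} (ρ : ∀ a, Matrix (J a) (J a) ℂ) (X : Matrix κ (Σ a, J a) ℂ)
    (a : I) (i : J a) (k : κ) :
    (X * Matrix.blockDiagonal' ρ) k ⟨a, i⟩ = ∑ j, X k ⟨a, j⟩ * ρ a j i := by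
  rw [Matrix.mul_apply, Fintype.sum_sigma, Finset.sum_eq_single a]
  · simp [Matrix.blockDiagonal'_apply_eq]
  · intro b _ hb
    simp [Matrix.blockDiagonal'_apply_ne _ _ _ hb]
  · simp

/-- An intertwiner of block diagonal matrices is a family of intertwiners of the blocks. -/
theorem finrank_intertwiners_blockDiagonal' {I : Type*} [Fintype I] [DecidableEq I]
    {J : I → Type*} [∀ a, Fintype (J a)] (ρ σ : ∀ a, Matrix (J a) (J a) ℂ) :
    Module.finrank ℂ (intertwiners (Matrix.blockDiagonal' ρ) (Matrix.blockDiagonal' σ)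
      (Matrix.blockDiagonal' ρ) (Matrix.blockDiagonal' σ)) =
      ∑ a, ∑ b, Module.finrank ℂ (intertwiners (ρ a) (σ a) (ρ b) (σ b)) := by
  have e : intertwiners (Matrix.blockDiagonal' ρ) (Matrix.blockDiagonal' σ)
      (Matrix.blockDiagonal' ρ) (Matrix.blockDiagonal' σ) ≃ₗ[ℂ]
      ∀ a, ∀ b, intertwiners (ρ a) (σ a) (ρ b) (σ b) :=
    { toFun := fun X a b => ⟨Matrix.of fun i j => X.1 ⟨a, i⟩ ⟨b, j⟩, by
        constructor
        · ext i j
          have := congrFun (congrFun X.2.1 ⟨a, i⟩) ⟨b, j⟩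
          rwa [blockDiagonal'_mul_apply, mul_blockDiagonal'_apply] at this
        · ext i j
          have := congrFun (congrFun X.2.2 ⟨a, i⟩) ⟨b, j⟩
          rwa [blockDiagonal'_mul_apply, mul_blockDiagonal'_apply] at this⟩
      invFun := fun Y => ⟨Matrix.of fun x y => (Y x.1 y.1).1 x.2 y.2, by
        constructor
        · ext ⟨a, i⟩ ⟨b, j⟩
          rw [blockDiagonal'_mul_apply, mul_blockDiagonal'_apply]
          exact congrFun (congrFun (Y a b).2.1 i) j
        · ext ⟨a, i⟩ ⟨b, j⟩
          rw [blockDiagonal'_mul_apply, mul_blockDiagonal'_apply]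
          exact congrFun (congrFun (Y a b).2.2 i) j⟩
      map_add' := fun _ _ => rfl
      map_smul' := fun _ _ => rfl
      left_inv := fun _ => rfl
      right_inv := fun _ => rfl }
  rw [e.finrank_eq, Module.finrank_pi_fintype]
  exact Finset.sum_congr rfl fun a _ => Module.finrank_pi_fintype ℂ

/-- The product of two decompositions into blocks, indexed by pairs of blocks. -/
def sigmaProdEquiv {I : Type*} (J : I → Type*) :
    ((Σ a, J a) × (Σ a, J a)) ≃ Σ p : I × I, J p.1 × J p.2 where
  toFun x := ⟨(x.1.1, x.2.1), (x.1.2, x.2.2)⟩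
  invFun y := (⟨y.1.1, y.2.1⟩, ⟨y.1.2, y.2.2⟩)
  left_inv _ := rfl
  right_inv _ := rfl

theorem blockDiagonal'_kronecker {I : Type*} [DecidableEq I] {J : I → Type*}
    (ρ σ : ∀ a, Matrix (J a) (J a) ℂ) :
    Matrix.blockDiagonal' ρ ⊗ₖ Matrix.blockDiagonal' σ =
      (Matrix.blockDiagonal' fun p : I × I => ρ p.1 ⊗ₖ σ p.2).submatrix
        (sigmaProdEquiv J) (sigmaProdEquiv J) := by
  ext ⟨⟨a, i⟩, ⟨b, j⟩⟩ ⟨⟨a', i'⟩, ⟨b', j'⟩⟩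
  simp only [Matrix.kroneckerMap_apply, Matrix.submatrix_apply, sigmaProdEquiv, Equiv.coe_fn_mk]
  by_cases ha : a = a'
  · by_cases hb : b = b'
    · subst ha hb
      simp [Matrix.blockDiagonal'_apply_eq]
    · rw [Matrix.blockDiagonal'_apply_ne σ _ _ hb, mul_zero, Matrix.blockDiagonal'_apply_ne]
      exact fun h => hb (Prod.ext_iff.1 h).2
  · rw [Matrix.blockDiagonal'_apply_ne ρ _ _ ha, zero_mul, Matrix.blockDiagonal'_apply_ne]
    exact fun h => ha (Prod.ext_iff.1 h).1

/-- The tensor cube of `X̄ = V ⊗ W` as the product of the tensor cubes of `V` and `W`. -/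
def tripleProdComm (α β : Type*) :
    ((α × β) × (α × β) × (α × β)) ≃ ((α × α × α) × (β × β × β)) where
  toFun x := ((x.1.1, x.2.1.1, x.2.2.1), (x.1.2, x.2.1.2, x.2.2.2))
  invFun y := ((y.1.1, y.2.1), (y.1.2.1, y.2.2.1), (y.1.2.2, y.2.2.2))
  left_inv _ := rfl
  right_inv _ := rfl

theorem ampL_involX (n m : ℕ) (q : ℂ) : ampL (involX n m q) =
    (ampL (invol n q) ⊗ₖ ampL (invol m q)).submatrix (tripleProdComm _ _) (tripleProdComm _ _) := by
  ext r c
  by_cases h1 : r.2.2.1 = c.2.2.1 <;> by_cases h2 : r.2.2.2 = c.2.2.2 <;>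
    simp [ampL, involX, tripleProdComm, Prod.ext_iff, h1, h2]

theorem ampR_involX (n m : ℕ) (q : ℂ) : ampR (involX n m q) =
    (ampR (invol n q) ⊗ₖ ampR (invol m q)).submatrix (tripleProdComm _ _) (tripleProdComm _ _) := by
  ext r c
  by_cases h1 : r.1.1 = c.1.1 <;> by_cases h2 : r.1.2 = c.1.2 <;>
    simp [ampR, involX, tripleProdComm, Prod.ext_iff, h1, h2]

/-- If the cubic operators on `V` are block diagonal in some basis, then the dimension of
`O(M_q(V ⊗ V))` in degree 3 is computed block by block. -/
theorem finrank_component_three_eq_sum {n : ℕ} {q : ℂ} (hq : q ≠ 0) (hq2 : q ^ 2 ≠ -1)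
    {I : Type*} [Fintype I] [DecidableEq I] {J : I → Type*} [∀ a, Fintype (J a)]
    [∀ a, DecidableEq (J a)] (ρ σ : ∀ a, Matrix (J a) (J a) ℂ)
    (T : Matrix (Fin n × Fin n × Fin n) (Σ a, J a) ℂ)
    (T' : Matrix (Σ a, J a) (Fin n × Fin n × Fin n) ℂ) (h1 : T * T' = 1) (h2 : T' * T = 1)
    (hL : ampL (invol n q) * T = T * Matrix.blockDiagonal' ρ)
    (hR : ampR (invol n q) * T = T * Matrix.blockDiagonal' σ) :
    Module.finrank ℂ (component n n q 3) = ∑ x : I × I, ∑ y : I × I, Module.finrank ℂ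
      (intertwiners (ρ x.1 ⊗ₖ ρ x.2) (σ x.1 ⊗ₖ σ x.2) (ρ y.1 ⊗ₖ ρ y.2) (σ y.1 ⊗ₖ σ y.2)) := by
  rw [finrank_component_three n n hq hq2, ampL_involX, ampR_involX, finrank_intertwiners_reindex,
    finrank_intertwiners_conj (C := Matrix.blockDiagonal' ρ ⊗ₖ Matrix.blockDiagonal' ρ)
      (D := Matrix.blockDiagonal' σ ⊗ₖ Matrix.blockDiagonal' σ) (T ⊗ₖ T) (T' ⊗ₖ T'),
    blockDiagonal'_kronecker, blockDiagonal'_kronecker, finrank_intertwiners_reindex,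
    finrank_intertwiners_blockDiagonal']
  · rw [← Matrix.mul_kronecker_mul, h1, Matrix.one_kronecker_one]
  · rw [← Matrix.mul_kronecker_mul, h2, Matrix.one_kronecker_one]
  · rw [← Matrix.mul_kronecker_mul, hL, Matrix.mul_kronecker_mul]
  · rw [← Matrix.mul_kronecker_mul, hR, Matrix.mul_kronecker_mul]

/-! ### The tensor cube of a two-dimensional space -/

theorem invol_two {q : ℂ} (hq : q ≠ 0) (hq2 : q ^ 2 ≠ -1) (r c : Fin 2 × Fin 2) :
    invol 2 q r c =
      ![![![![1, 0], ![0, 0]],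
          ![![0, (q ^ 2 - 1) / (1 + q ^ 2)], ![2 * q / (1 + q ^ 2), 0]]],
        ![![![0, 2 * q / (1 + q ^ 2)], ![-((q ^ 2 - 1) / (1 + q ^ 2)), 0]],
          ![![0, 0], ![0, 1]]]] r.1 r.2 c.1 c.2 := by
  have h : 1 + q ^ 2 ≠ 0 := fun h => hq2 (by linear_combination h)
  have h' : q ^ 2 + 1 ≠ 0 := by rwa [add_comm]
  obtain ⟨i, j⟩ := r
  obtain ⟨k, l⟩ := c
  fin_cases i <;> fin_cases j <;> fin_cases k <;> fin_cases l <;>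
    simp [invol, braiding] <;> field_simp <;> ring

/-- The dimensions of the trivial (`false`) and of the two-dimensional (`true`) block. -/
def blockDim : Bool → ℕ
  | false => 1
  | true => 2

/-- The first involution on a block. -/
def blockL : ∀ t : Bool, Matrix (Fin (blockDim t)) (Fin (blockDim t)) ℂ
  | false => !![1]
  | true => !![1, 0; 0, -1]

/-- The second involution on a block. -/
def blockR (c e f : ℂ) : ∀ t : Bool, Matrix (Fin (blockDim t)) (Fin (blockDim t)) ℂ
  | false => !![1]
  | true => !![c, e; f, -c]

/-- The kinds of the blocks of the tensor cube. -/
def blockKind : Fin 4 ⊕ Fin 2 → Bool :=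
  Sum.elim (fun _ => false) (fun _ => true)

/-- The invariant vectors of the tensor cube. -/
def trivVec (q : ℂ) : Fin 4 → Fin 2 → Fin 2 → Fin 2 → ℂ :=
  -- These are the quantum symmetric tensors, one for each weight: `111`, `222`, `112`, `122`.
  ![![![![1, 0], ![0, 0]], ![![0, 0], ![0, 0]]],
    ![![![0, 0], ![0, 0]], ![![0, 0], ![0, 1]]],
    ![![![0, q ^ 2], ![q, 0]], ![![1, 0], ![0, 0]]],
    ![![![0, 0], ![0, q ^ 2]], ![![0, q], ![1, 0]]]]

/-- The vectors that span the two-dimensional blocks of the tensor cube. -/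
def stdVec (q : ℂ) : Fin 2 → Fin 2 → Fin 2 → Fin 2 → Fin 2 → ℂ :=
  -- One block in weight `112` and one in weight `122`. Vector `0` is fixed by the first involution
  -- and vector `1` is negated by it; the scalings are chosen so that the second involution has the
  -- same matrix in both blocks.
  ![![![![![0, -(1 + q ^ 2)], ![q ^ 3, 0]], ![![q ^ 2, 0], ![0, 0]]],
      ![![![0, 0], ![1, 0]], ![![-q, 0], ![0, 0]]]],
    ![![![![0, 0], ![0, -q]], ![![0, -1], ![q * (1 + q ^ 2), 0]]],
      ![![![0, 0], ![0, 1]], ![![0, -q], ![0, 0]]]]]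

/-- A basis of the tensor cube of a two-dimensional space adapted to the blocks. -/
def cubeBasis (q : ℂ) :
    Matrix (Fin 2 × Fin 2 × Fin 2) (Σ a, Fin (blockDim (blockKind a))) ℂ :=
  Matrix.of fun v x => match x with
    | ⟨Sum.inl k, _⟩ => trivVec q k v.1 v.2.1 v.2.2
    | ⟨Sum.inr k, i⟩ => stdVec q k i v.1 v.2.1 v.2.2

/-- The square lengths of the vectors of `cubeBasis`. -/
def cubeNorm (q : ℂ) : (Σ a, Fin (blockDim (blockKind a))) → ℂ
  | ⟨Sum.inl k, _⟩ => (![1, 1, 1 + q ^ 2 + q ^ 4, 1 + q ^ 2 + q ^ 4] : Fin 4 → ℂ) k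
  | ⟨Sum.inr _, i⟩ => (![(1 + q ^ 2) * (1 + q ^ 2 + q ^ 4), 1 + q ^ 2] : Fin 2 → ℂ) i

theorem cubeNorm_ne_zero {q : ℂ} (h : 1 + q ^ 2 ≠ 0) (hq4 : 1 + q ^ 2 + q ^ 4 ≠ 0)
    (x : Σ a, Fin (blockDim (blockKind a))) : cubeNorm q x ≠ 0 := by
  obtain ⟨a | a, i⟩ := x
  · fin_cases a <;> simp [cubeNorm, hq4]
  · change Fin 2 at i
    fin_cases i <;> simp [cubeNorm, hq4, h]

theorem sum_trivVec_mul_trivVec (q : ℂ) (a b : Fin 4) :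
    ∑ u, ∑ v, ∑ w, trivVec q a u v w * trivVec q b u v w =
      if a = b then (![1, 1, 1 + q ^ 2 + q ^ 4, 1 + q ^ 2 + q ^ 4] : Fin 4 → ℂ) a else 0 := by
  fin_cases a <;> fin_cases b <;> simp [trivVec] <;> ring

theorem sum_trivVec_mul_stdVec (q : ℂ) (a : Fin 4) (b j : Fin 2) :
    ∑ u, ∑ v, ∑ w, trivVec q a u v w * stdVec q b j u v w = 0 := by
  fin_cases a <;> fin_cases b <;> fin_cases j <;> simp [trivVec, stdVec] <;> ring

theorem sum_stdVec_mul_stdVec (q : ℂ) (a i b j : Fin 2) :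
    ∑ u, ∑ v, ∑ w, stdVec q a i u v w * stdVec q b j u v w =
      if a = b ∧ i = j then (![(1 + q ^ 2) * (1 + q ^ 2 + q ^ 4), 1 + q ^ 2] : Fin 2 → ℂ) i
        else 0 := by
  fin_cases a <;> fin_cases b <;> fin_cases i <;> fin_cases j <;> simp [stdVec] <;> ring

/-- Orthogonality for the bilinear dot product exhibits the inverse as the transpose with rescaled
rows, so no 8 by 8 inversion is needed. -/
theorem cubeBasis_orthogonal (q : ℂ) :
    (cubeBasis q).transpose * cubeBasis q = Matrix.diagonal (cubeNorm q) := by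
  ext ⟨a | a, i⟩ ⟨b | b, j⟩ <;>
    rw [Matrix.mul_apply] <;> simp only [Fintype.sum_prod_type]
  · change Fin 1 at i j
    refine (sum_trivVec_mul_trivVec q a b).trans ?_
    by_cases h : a = b
    · subst h
      obtain rfl : i = j := Subsingleton.elim _ _
      rw [if_pos rfl, Matrix.diagonal_apply_eq]
      rfl
    · rw [if_neg h, Matrix.diagonal_apply_ne]
      rintro ⟨⟩
      exact h rfl
  · rw [Matrix.diagonal_apply_ne _ (by simp)]
    exact sum_trivVec_mul_stdVec q a b j
  · rw [Matrix.diagonal_apply_ne _ (by simp), ← sum_trivVec_mul_stdVec q b a i]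
    exact Fintype.sum_congr _ _ fun u => Fintype.sum_congr _ _ fun v =>
      Fintype.sum_congr _ _ fun w => mul_comm _ _
  · change Fin 2 at i j
    refine (sum_stdVec_mul_stdVec q a i b j).trans ?_
    by_cases h : a = b ∧ i = j
    · obtain ⟨rfl, rfl⟩ := h
      rw [if_pos ⟨rfl, rfl⟩, Matrix.diagonal_apply_eq]
      rfl
    · rw [if_neg h, Matrix.diagonal_apply_ne]
      rintro ⟨⟩
      exact h ⟨rfl, rfl⟩

/-- The inverse of `cubeBasis`. -/
def cubeBasisInv (q : ℂ) :
    Matrix (Σ a, Fin (blockDim (blockKind a))) (Fin 2 × Fin 2 × Fin 2) ℂ :=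
  Matrix.diagonal (fun x => (cubeNorm q x)⁻¹) * (cubeBasis q).transpose

theorem cubeBasisInv_mul {q : ℂ} (h : 1 + q ^ 2 ≠ 0) (hq4 : 1 + q ^ 2 + q ^ 4 ≠ 0) :
    cubeBasisInv q * cubeBasis q = 1 := by
  rw [cubeBasisInv, Matrix.mul_assoc, cubeBasis_orthogonal, Matrix.diagonal_mul_diagonal,
    ← Matrix.diagonal_one]
  congr 1
  ext x
  exact inv_mul_cancel₀ (cubeNorm_ne_zero h hq4 x)

theorem mul_cubeBasisInv {q : ℂ} (h : 1 + q ^ 2 ≠ 0) (hq4 : 1 + q ^ 2 + q ^ 4 ≠ 0) :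
    cubeBasis q * cubeBasisInv q = 1 :=
  -- The two index types differ but both have 8 elements: `2³ = 4 · 1 + 2 · 2`.
  (Matrix.mul_eq_one_comm_of_card_eq _ _ ℂ (by rfl)).1 (cubeBasisInv_mul h hq4)

theorem involL_trivVec {q : ℂ} (hq : q ≠ 0) (hq2 : q ^ 2 ≠ -1) (a : Fin 4) (u v w : Fin 2) :
    ∑ x, ∑ y, invol 2 q (u, v) (x, y) * trivVec q a x y w = trivVec q a u v w := by
  have h : 1 + q ^ 2 ≠ 0 := fun h => hq2 (by linear_combination h)
  fin_cases u <;> fin_cases v <;> fin_cases w <;> fin_cases a <;>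
    simp [invol_two hq hq2, trivVec] <;> (try field_simp) <;> (try ring)

theorem involR_trivVec {q : ℂ} (hq : q ≠ 0) (hq2 : q ^ 2 ≠ -1) (a : Fin 4) (u v w : Fin 2) :
    ∑ x, ∑ y, invol 2 q (v, w) (x, y) * trivVec q a u x y = trivVec q a u v w := by
  have h : 1 + q ^ 2 ≠ 0 := fun h => hq2 (by linear_combination h)
  fin_cases u <;> fin_cases v <;> fin_cases w <;> fin_cases a <;>
    simp [invol_two hq hq2, trivVec] <;> (try field_simp) <;> (try ring)

theorem involL_stdVec {q : ℂ} (hq : q ≠ 0) (hq2 : q ^ 2 ≠ -1) (a i u v w : Fin 2) :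
    ∑ x, ∑ y, invol 2 q (u, v) (x, y) * stdVec q a i x y w =
      ∑ j, stdVec q a j u v w * (!![1, 0; 0, -1] : Matrix (Fin 2) (Fin 2) ℂ) j i := by
  have h : 1 + q ^ 2 ≠ 0 := fun h => hq2 (by linear_combination h)
  fin_cases u <;> fin_cases v <;> fin_cases w <;> fin_cases a <;> fin_cases i <;>
    simp [invol_two hq hq2, stdVec] <;> (try field_simp) <;> (try ring)

/-- The upper left entry is the parameter `c`. It equals `-1/2` at `q = 1`, as in the
two-dimensional representation of the symmetric group on three letters. -/
theorem involR_stdVec {q : ℂ} (hq : q ≠ 0) (hq2 : q ^ 2 ≠ -1) (a i u v w : Fin 2) :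
    ∑ x, ∑ y, invol 2 q (v, w) (x, y) * stdVec q a i u x y =
      ∑ j, stdVec q a j u v w * (!![-(1 + q ^ 4) / (1 + q ^ 2) ^ 2, -2 * q / (1 + q ^ 2) ^ 2;
        -2 * q * (1 + q ^ 2 + q ^ 4) / (1 + q ^ 2) ^ 2, -(-(1 + q ^ 4) / (1 + q ^ 2) ^ 2)] :
          Matrix (Fin 2) (Fin 2) ℂ) j i := by
  have h : 1 + q ^ 2 ≠ 0 := fun h => hq2 (by linear_combination h)
  fin_cases u <;> fin_cases v <;> fin_cases w <;> fin_cases a <;> fin_cases i <;>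
    simp [invol_two hq hq2, stdVec] <;> (try field_simp) <;> (try ring)

theorem ampL_mul_cubeBasis {q : ℂ} (hq : q ≠ 0) (hq2 : q ^ 2 ≠ -1) :
    ampL (invol 2 q) * cubeBasis q =
      cubeBasis q * Matrix.blockDiagonal' fun a => blockL (blockKind a) := by
  ext ⟨u, v, w⟩ ⟨a | a, i⟩
  · rw [ampL_mul_apply, mul_blockDiagonal'_apply, Fintype.sum_prod_type]
    refine (involL_trivVec hq hq2 a u v w).trans ?_
    change _ = ∑ j : Fin 1, trivVec q a u v w * (!![1] : Matrix (Fin 1) (Fin 1) ℂ) j i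
    change Fin 1 at i
    simp [Subsingleton.elim i 0]
  · rw [ampL_mul_apply, mul_blockDiagonal'_apply, Fintype.sum_prod_type]
    exact involL_stdVec hq hq2 a i u v w

theorem ampR_mul_cubeBasis {q : ℂ} (hq : q ≠ 0) (hq2 : q ^ 2 ≠ -1) :
    ampR (invol 2 q) * cubeBasis q =
      cubeBasis q * Matrix.blockDiagonal' fun a => blockR (-(1 + q ^ 4) / (1 + q ^ 2) ^ 2)
        (-2 * q / (1 + q ^ 2) ^ 2) (-2 * q * (1 + q ^ 2 + q ^ 4) / (1 + q ^ 2) ^ 2)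
        (blockKind a) := by
  ext ⟨u, v, w⟩ ⟨a | a, i⟩
  · rw [ampR_mul_apply, mul_blockDiagonal'_apply, Fintype.sum_prod_type]
    refine (involR_trivVec hq hq2 a u v w).trans ?_
    change _ = ∑ j : Fin 1, trivVec q a u v w * (!![1] : Matrix (Fin 1) (Fin 1) ℂ) j i
    change Fin 1 at i
    simp [Subsingleton.elim i 0]
  · rw [ampR_mul_apply, mul_blockDiagonal'_apply, Fintype.sum_prod_type]
    exact involR_stdVec hq hq2 a i u v w

/-! ### Intertwiners between tensor products of blocks -/

theorem finrank_eq_of_coordinates {M : Type*} [AddCommGroup M] [Module ℂ M]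
    (p : Submodule ℂ M) {k : ℕ} (f : M →ₗ[ℂ] Fin k → ℂ) (inj : ∀ X ∈ p, f X = 0 → X = 0)
    (surj : ∀ v, ∃ X ∈ p, f X = v) : Module.finrank ℂ p = k := by
  have e : p ≃ₗ[ℂ] (Fin k → ℂ) := LinearEquiv.ofBijective (f.domRestrict p)
    ⟨by
      rw [← LinearMap.ker_eq_bot, LinearMap.ker_eq_bot']
      exact fun X hX => Subtype.ext (inj X X.2 hX), fun v => by
      obtain ⟨X, hX, h⟩ := surj v
      exact ⟨⟨X, hX⟩, h⟩⟩
  rw [e.finrank_eq, Module.finrank_fin_fun]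

theorem finrank_eq_one_of_entry {ι κ : Type*} (p : Submodule ℂ (Matrix ι κ ℂ)) (i : ι) (j : κ)
    (inj : ∀ X ∈ p, X i j = 0 → X = 0) (M : Matrix ι κ ℂ) (hM : M ∈ p) (h : M i j ≠ 0) :
    Module.finrank ℂ p = 1 := by
  refine finrank_eq_of_coordinates p
    (LinearMap.pi fun _ => Matrix.entryLinearMap ℂ ℂ i j) (fun X hX h => inj X hX ?_)
    fun v => ⟨(v 0 / M i j) • M, p.smul_mem _ hM, ?_⟩
  · exact congrFun h 0
  · ext k
    rw [Subsingleton.elim k 0]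
    simp [h]

/-- A pair of square matrices. -/
abbrev MatPair (a : ℕ) := Matrix (Fin a) (Fin a) ℂ × Matrix (Fin a) (Fin a) ℂ

/-- The intertwiners between two products of pairs of matrices. -/
abbrev prodHom {a b a' b' : ℕ} (ρ : MatPair a) (σ : MatPair b) (ρ' : MatPair a')
    (σ' : MatPair b') : Submodule ℂ (Matrix (Fin a × Fin b) (Fin a' × Fin b') ℂ) :=
  intertwiners (ρ.1 ⊗ₖ σ.1) (ρ.2 ⊗ₖ σ.2) (ρ'.1 ⊗ₖ σ'.1) (ρ'.2 ⊗ₖ σ'.2)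

/-- The trivial block. -/
abbrev trivPair : MatPair 1 := (!![1], !![1])

/-- The two-dimensional block. -/
abbrev stdPair (c e f : ℂ) : MatPair 2 := (!![1, 0; 0, -1], !![c, e; f, -c])

/-- The hypothesis, which says that the second matrix of `stdPair` squares to `1`, factors as `e f =
(1 - c)(1 + c)`. -/
theorem one_sub_ne_zero_of_mul {c e f : ℂ} (h : e * f = 1 - c ^ 2) (he : e ≠ 0) (hf : f ≠ 0) :
     1 - c ≠ 0 := fun h1 =>
  mul_ne_zero he hf (by linear_combination h + (1 + c) * h1)

/-- The two-dimensional block has no invariant covector: the first involution leaves only multiples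
of the first coordinate, and the second moves those because `e ≠ 0`. -/
theorem finrank_prodHom_triv_triv_triv_std {c e f : ℂ} (h : e * f = 1 - c ^ 2)
    (he : e ≠ 0) (hf : f ≠ 0) :
    Module.finrank ℂ (prodHom trivPair trivPair trivPair (stdPair c e f)) = 0 := by
  have hc1 := one_sub_ne_zero_of_mul h he hf
  refine finrank_eq_of_coordinates _ (0 : _ →ₗ[ℂ] Fin 0 → ℂ) ?_
    fun v => ⟨0, zero_mem _, Subsingleton.elim _ _⟩
  rintro X ⟨h1, h2⟩ -
  rw [← Matrix.ext_iff] at h1 h2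
  simp only [Matrix.mul_apply, Fintype.sum_prod_type, Prod.forall, Fin.forall_fin_two,
    Fin.forall_fin_one, Fin.sum_univ_two, Fin.sum_univ_one, Matrix.kroneckerMap_apply,
    Matrix.of_apply, Matrix.cons_val] at h1 h2
  rw [← Matrix.ext_iff]
  simp only [Prod.forall, Fin.forall_fin_two, Fin.forall_fin_one, Matrix.zero_apply]
  grind

theorem finrank_prodHom_triv_triv_std_triv {c e f : ℂ} (h : e * f = 1 - c ^ 2)
    (he : e ≠ 0) (hf : f ≠ 0) :
    Module.finrank ℂ (prodHom trivPair trivPair (stdPair c e f) trivPair) = 0 := by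
  have hc1 := one_sub_ne_zero_of_mul h he hf
  refine finrank_eq_of_coordinates _ (0 : _ →ₗ[ℂ] Fin 0 → ℂ) ?_
    fun v => ⟨0, zero_mem _, Subsingleton.elim _ _⟩
  rintro X ⟨h1, h2⟩ -
  rw [← Matrix.ext_iff] at h1 h2
  simp only [Matrix.mul_apply, Fintype.sum_prod_type, Prod.forall, Fin.forall_fin_two,
    Fin.forall_fin_one, Fin.sum_univ_two, Fin.sum_univ_one, Matrix.kroneckerMap_apply,
    Matrix.of_apply, Matrix.cons_val] at h1 h2
  rw [← Matrix.ext_iff]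
  simp only [Prod.forall, Fin.forall_fin_two, Fin.forall_fin_one, Matrix.zero_apply]
  grind

theorem finrank_prodHom_triv_std_triv_triv {c e f : ℂ} (h : e * f = 1 - c ^ 2)
    (he : e ≠ 0) (hf : f ≠ 0) :
    Module.finrank ℂ (prodHom trivPair (stdPair c e f) trivPair trivPair) = 0 := by
  have hc1 := one_sub_ne_zero_of_mul h he hf
  refine finrank_eq_of_coordinates _ (0 : _ →ₗ[ℂ] Fin 0 → ℂ) ?_
    fun v => ⟨0, zero_mem _, Subsingleton.elim _ _⟩
  rintro X ⟨h1, h2⟩ -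
  rw [← Matrix.ext_iff] at h1 h2
  simp only [Matrix.mul_apply, Fintype.sum_prod_type, Prod.forall, Fin.forall_fin_two,
    Fin.forall_fin_one, Fin.sum_univ_two, Fin.sum_univ_one, Matrix.kroneckerMap_apply,
    Matrix.of_apply, Matrix.cons_val] at h1 h2
  rw [← Matrix.ext_iff]
  simp only [Prod.forall, Fin.forall_fin_two, Fin.forall_fin_one, Matrix.zero_apply]
  grind

theorem finrank_prodHom_std_triv_triv_triv {c e f : ℂ} (h : e * f = 1 - c ^ 2)
    (he : e ≠ 0) (hf : f ≠ 0) :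
    Module.finrank ℂ (prodHom (stdPair c e f) trivPair trivPair trivPair) = 0 := by
  have hc1 := one_sub_ne_zero_of_mul h he hf
  refine finrank_eq_of_coordinates _ (0 : _ →ₗ[ℂ] Fin 0 → ℂ) ?_
    fun v => ⟨0, zero_mem _, Subsingleton.elim _ _⟩
  rintro X ⟨h1, h2⟩ -
  rw [← Matrix.ext_iff] at h1 h2
  simp only [Matrix.mul_apply, Fintype.sum_prod_type, Prod.forall, Fin.forall_fin_two,
    Fin.forall_fin_one, Fin.sum_univ_two, Fin.sum_univ_one, Matrix.kroneckerMap_apply,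
    Matrix.of_apply, Matrix.cons_val] at h1 h2
  rw [← Matrix.ext_iff]
  simp only [Prod.forall, Fin.forall_fin_two, Fin.forall_fin_one, Matrix.zero_apply]
  grind

/-- This is where the quantum case departs from the classical one. The only constituent of the
tensor square that could be the block itself is the one of angle `2θ`; equality of traces would mean
`2c² - 1 = c`, that is `(2c + 1)(c - 1) = 0`. -/
theorem finrank_prodHom_triv_std_std_std {c e f : ℂ} (h : e * f = 1 - c ^ 2)
    (he : e ≠ 0) (hf : f ≠ 0) (hc2 : 1 + 2 * c ≠ 0) :
    Module.finrank ℂ (prodHom trivPair (stdPair c e f) (stdPair c e f) (stdPair c e f)) = 0 := by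
  have hc1 := one_sub_ne_zero_of_mul h he hf
  refine finrank_eq_of_coordinates _ (0 : _ →ₗ[ℂ] Fin 0 → ℂ) ?_
    fun v => ⟨0, zero_mem _, Subsingleton.elim _ _⟩
  rintro X ⟨h1, h2⟩ -
  rw [← Matrix.ext_iff] at h1 h2
  simp only [Matrix.mul_apply, Fintype.sum_prod_type, Prod.forall, Fin.forall_fin_two,
    Fin.forall_fin_one, Fin.sum_univ_two, Fin.sum_univ_one, Matrix.kroneckerMap_apply,
    Matrix.of_apply, Matrix.cons_val] at h1 h2
  rw [← Matrix.ext_iff]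
  simp only [Prod.forall, Fin.forall_fin_two, Fin.forall_fin_one, Matrix.zero_apply]
  grind

theorem finrank_prodHom_std_triv_std_std {c e f : ℂ} (h : e * f = 1 - c ^ 2)
    (he : e ≠ 0) (hf : f ≠ 0) (hc2 : 1 + 2 * c ≠ 0) :
    Module.finrank ℂ (prodHom (stdPair c e f) trivPair (stdPair c e f) (stdPair c e f)) = 0 := by
  have hc1 := one_sub_ne_zero_of_mul h he hf
  refine finrank_eq_of_coordinates _ (0 : _ →ₗ[ℂ] Fin 0 → ℂ) ?_
    fun v => ⟨0, zero_mem _, Subsingleton.elim _ _⟩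
  rintro X ⟨h1, h2⟩ -
  rw [← Matrix.ext_iff] at h1 h2
  simp only [Matrix.mul_apply, Fintype.sum_prod_type, Prod.forall, Fin.forall_fin_two,
    Fin.forall_fin_one, Fin.sum_univ_two, Fin.sum_univ_one, Matrix.kroneckerMap_apply,
    Matrix.of_apply, Matrix.cons_val] at h1 h2
  rw [← Matrix.ext_iff]
  simp only [Prod.forall, Fin.forall_fin_two, Fin.forall_fin_one, Matrix.zero_apply]
  grind

theorem finrank_prodHom_std_std_triv_std {c e f : ℂ} (h : e * f = 1 - c ^ 2)
    (he : e ≠ 0) (hf : f ≠ 0) (hc2 : 1 + 2 * c ≠ 0) :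
    Module.finrank ℂ (prodHom (stdPair c e f) (stdPair c e f) trivPair (stdPair c e f)) = 0 := by
  have hc1 := one_sub_ne_zero_of_mul h he hf
  refine finrank_eq_of_coordinates _ (0 : _ →ₗ[ℂ] Fin 0 → ℂ) ?_
    fun v => ⟨0, zero_mem _, Subsingleton.elim _ _⟩
  rintro X ⟨h1, h2⟩ -
  rw [← Matrix.ext_iff] at h1 h2
  simp only [Matrix.mul_apply, Fintype.sum_prod_type, Prod.forall, Fin.forall_fin_two,
    Fin.forall_fin_one, Fin.sum_univ_two, Fin.sum_univ_one, Matrix.kroneckerMap_apply,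
    Matrix.of_apply, Matrix.cons_val] at h1 h2
  rw [← Matrix.ext_iff]
  simp only [Prod.forall, Fin.forall_fin_two, Fin.forall_fin_one, Matrix.zero_apply]
  grind

theorem finrank_prodHom_std_std_std_triv {c e f : ℂ} (h : e * f = 1 - c ^ 2)
    (he : e ≠ 0) (hf : f ≠ 0) (hc2 : 1 + 2 * c ≠ 0) :
    Module.finrank ℂ (prodHom (stdPair c e f) (stdPair c e f) (stdPair c e f) trivPair) = 0 := by
  have hc1 := one_sub_ne_zero_of_mul h he hf
  refine finrank_eq_of_coordinates _ (0 : _ →ₗ[ℂ] Fin 0 → ℂ) ?_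
    fun v => ⟨0, zero_mem _, Subsingleton.elim _ _⟩
  rintro X ⟨h1, h2⟩ -
  rw [← Matrix.ext_iff] at h1 h2
  simp only [Matrix.mul_apply, Fintype.sum_prod_type, Prod.forall, Fin.forall_fin_two,
    Fin.forall_fin_one, Fin.sum_univ_two, Fin.sum_univ_one, Matrix.kroneckerMap_apply,
    Matrix.of_apply, Matrix.cons_val] at h1 h2
  rw [← Matrix.ext_iff]
  simp only [Prod.forall, Fin.forall_fin_two, Fin.forall_fin_one, Matrix.zero_apply]
  grind

theorem finrank_prodHom_triv_triv_triv_triv {c e f : ℂ} (h : e * f = 1 - c ^ 2)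
    (he : e ≠ 0) (hf : f ≠ 0) :
    Module.finrank ℂ (prodHom trivPair trivPair trivPair trivPair) = 1 := by
  have hc1 := one_sub_ne_zero_of_mul h he hf
  refine finrank_eq_one_of_entry _ (0, 0) (0, 0) ?_ 1 ?_ ?_
  · rintro X ⟨h1, h2⟩ h3
    rw [← Matrix.ext_iff] at h1 h2
    simp only [Matrix.mul_apply, Fintype.sum_prod_type, Prod.forall,
      Fin.forall_fin_one, Fin.sum_univ_one, Matrix.kroneckerMap_apply,
      Matrix.of_apply, Matrix.cons_val] at h1 h2
    rw [← Matrix.ext_iff]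
    simp only [Prod.forall, Fin.forall_fin_one, Matrix.zero_apply]
    grind
  · simp [mem_intertwiners]
  · simp

/-- Schur's lemma: commuting with `diag(1, -1)` forces a diagonal matrix, and the off-diagonal
entries of the second involution make it scalar. -/
theorem finrank_prodHom_triv_std_triv_std {c e f : ℂ} (h : e * f = 1 - c ^ 2)
    (he : e ≠ 0) (hf : f ≠ 0) :
    Module.finrank ℂ (prodHom trivPair (stdPair c e f) trivPair (stdPair c e f)) = 1 := by
  have hc1 := one_sub_ne_zero_of_mul h he hf
  refine finrank_eq_one_of_entry _ (0, 0) (0, 0) ?_ 1 ?_ ?_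
  · rintro X ⟨h1, h2⟩ h3
    rw [← Matrix.ext_iff] at h1 h2
    simp only [Matrix.mul_apply, Fintype.sum_prod_type, Prod.forall, Fin.forall_fin_two,
      Fin.forall_fin_one, Fin.sum_univ_two, Fin.sum_univ_one, Matrix.kroneckerMap_apply,
      Matrix.of_apply, Matrix.cons_val] at h1 h2
    rw [← Matrix.ext_iff]
    simp only [Prod.forall, Fin.forall_fin_two, Fin.forall_fin_one, Matrix.zero_apply]
    grind
  · simp [mem_intertwiners]
  · simp

theorem finrank_prodHom_std_triv_std_triv {c e f : ℂ} (h : e * f = 1 - c ^ 2)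
    (he : e ≠ 0) (hf : f ≠ 0) :
    Module.finrank ℂ (prodHom (stdPair c e f) trivPair (stdPair c e f) trivPair) = 1 := by
  have hc1 := one_sub_ne_zero_of_mul h he hf
  refine finrank_eq_one_of_entry _ (0, 0) (0, 0) ?_ 1 ?_ ?_
  · rintro X ⟨h1, h2⟩ h3
    rw [← Matrix.ext_iff] at h1 h2
    simp only [Matrix.mul_apply, Fintype.sum_prod_type, Prod.forall, Fin.forall_fin_two,
      Fin.forall_fin_one, Fin.sum_univ_two, Fin.sum_univ_one, Matrix.kroneckerMap_apply,
      Matrix.of_apply, Matrix.cons_val] at h1 h2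
    rw [← Matrix.ext_iff]
    simp only [Prod.forall, Fin.forall_fin_two, Fin.forall_fin_one, Matrix.zero_apply]
    grind
  · simp [mem_intertwiners]
  · simp

theorem finrank_prodHom_triv_std_std_triv {c e f : ℂ} (h : e * f = 1 - c ^ 2)
    (he : e ≠ 0) (hf : f ≠ 0) :
    Module.finrank ℂ (prodHom trivPair (stdPair c e f) (stdPair c e f) trivPair) = 1 := by
  have hc1 := one_sub_ne_zero_of_mul h he hf
  refine finrank_eq_one_of_entry _ (0, 0) (0, 0) ?_ (Matrix.of fun x y => if x.2 = y.1 then 1 else 0) ?_ ?_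
  · rintro X ⟨h1, h2⟩ h3
    rw [← Matrix.ext_iff] at h1 h2
    simp only [Matrix.mul_apply, Fintype.sum_prod_type, Prod.forall, Fin.forall_fin_two,
      Fin.forall_fin_one, Fin.sum_univ_two, Fin.sum_univ_one, Matrix.kroneckerMap_apply,
      Matrix.of_apply, Matrix.cons_val] at h1 h2
    rw [← Matrix.ext_iff]
    simp only [Prod.forall, Fin.forall_fin_two, Fin.forall_fin_one, Matrix.zero_apply]
    grind
  · rw [mem_intertwiners, ← Matrix.ext_iff, ← Matrix.ext_iff]
    simp [Matrix.mul_apply, Fintype.sum_prod_type]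
  · simp

theorem finrank_prodHom_std_triv_triv_std {c e f : ℂ} (h : e * f = 1 - c ^ 2)
    (he : e ≠ 0) (hf : f ≠ 0) :
    Module.finrank ℂ (prodHom (stdPair c e f) trivPair trivPair (stdPair c e f)) = 1 := by
  have hc1 := one_sub_ne_zero_of_mul h he hf
  refine finrank_eq_one_of_entry _ (0, 0) (0, 0) ?_ (Matrix.of fun x y => if x.1 = y.2 then 1 else 0) ?_ ?_
  · rintro X ⟨h1, h2⟩ h3
    rw [← Matrix.ext_iff] at h1 h2
    simp only [Matrix.mul_apply, Fintype.sum_prod_type, Prod.forall, Fin.forall_fin_two,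
      Fin.forall_fin_one, Fin.sum_univ_two, Fin.sum_univ_one, Matrix.kroneckerMap_apply,
      Matrix.of_apply, Matrix.cons_val] at h1 h2
    rw [← Matrix.ext_iff]
    simp only [Prod.forall, Fin.forall_fin_two, Fin.forall_fin_one, Matrix.zero_apply]
    grind
  · rw [mem_intertwiners, ← Matrix.ext_iff, ← Matrix.ext_iff]
    simp [Matrix.mul_apply, Fintype.sum_prod_type]
  · simp

/-- The witness is an invariant tensor: with `M = diag(e, f)` and `B` the second involution, `B M Bᵀ
= M` follows from `c² + e f = 1`. -/
theorem finrank_prodHom_std_std_triv_triv {c e f : ℂ} (h : e * f = 1 - c ^ 2)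
    (he : e ≠ 0) (hf : f ≠ 0) :
    Module.finrank ℂ (prodHom (stdPair c e f) (stdPair c e f) trivPair trivPair) = 1 := by
  have hc1 := one_sub_ne_zero_of_mul h he hf
  refine finrank_eq_one_of_entry _ (0, 0) (0, 0) ?_ (Matrix.of fun x _ => !![e, 0; 0, f] x.1 x.2) ?_ ?_
  · rintro X ⟨h1, h2⟩ h3
    rw [← Matrix.ext_iff] at h1 h2
    simp only [Matrix.mul_apply, Fintype.sum_prod_type, Prod.forall, Fin.forall_fin_two,
      Fin.forall_fin_one, Fin.sum_univ_two, Fin.sum_univ_one, Matrix.kroneckerMap_apply,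
      Matrix.of_apply, Matrix.cons_val] at h1 h2
    rw [← Matrix.ext_iff]
    simp only [Prod.forall, Fin.forall_fin_two, Fin.forall_fin_one, Matrix.zero_apply]
    grind
  · rw [mem_intertwiners, ← Matrix.ext_iff, ← Matrix.ext_iff]
    simp [Matrix.mul_apply, Fintype.sum_prod_type, Fin.forall_fin_two]
    grind
  · simp [he]

/-- Dually, `diag(f, e)` is the invariant bilinear form, since `Bᵀ diag(f, e) B = diag(f, e)` for
the second involution `B`. -/
theorem finrank_prodHom_triv_triv_std_std {c e f : ℂ} (h : e * f = 1 - c ^ 2)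
    (he : e ≠ 0) (hf : f ≠ 0) :
    Module.finrank ℂ (prodHom trivPair trivPair (stdPair c e f) (stdPair c e f)) = 1 := by
  have hc1 := one_sub_ne_zero_of_mul h he hf
  refine finrank_eq_one_of_entry _ (0, 0) (0, 0) ?_ (Matrix.of fun _ y => !![f, 0; 0, e] y.1 y.2) ?_ ?_
  · rintro X ⟨h1, h2⟩ h3
    rw [← Matrix.ext_iff] at h1 h2
    simp only [Matrix.mul_apply, Fintype.sum_prod_type, Prod.forall, Fin.forall_fin_two,
      Fin.forall_fin_one, Fin.sum_univ_two, Fin.sum_univ_one, Matrix.kroneckerMap_apply,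
      Matrix.of_apply, Matrix.cons_val] at h1 h2
    rw [← Matrix.ext_iff]
    simp only [Prod.forall, Fin.forall_fin_two, Fin.forall_fin_one, Matrix.zero_apply]
    grind
  · rw [mem_intertwiners, ← Matrix.ext_iff, ← Matrix.ext_iff]
    simp [Matrix.mul_apply, Fintype.sum_prod_type, Fin.forall_fin_two]
    grind
  · simp [hf]

/-- The tensor square has three pairwise non-isomorphic irreducible constituents: the trivial one,
the determinant and the one of angle `2θ`. If `c` vanished, the product of the involutions would act
on the last as `-1`, and it would split. -/
theorem finrank_prodHom_std_std_std_std {c e f : ℂ} (h : e * f = 1 - c ^ 2)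
    (he : e ≠ 0) (hf : f ≠ 0) (hc : c ≠ 0) :
    Module.finrank ℂ (prodHom (stdPair c e f) (stdPair c e f) (stdPair c e f)
      (stdPair c e f)) = 3 := by
  have hc1 := one_sub_ne_zero_of_mul h he hf
  refine finrank_eq_of_coordinates _ (LinearMap.pi
    ![Matrix.entryLinearMap ℂ ℂ (0, 0) (0, 0), Matrix.entryLinearMap ℂ ℂ (0, 0) (1, 1),
      Matrix.entryLinearMap ℂ ℂ (0, 1) (0, 1)]) ?_ fun v => ⟨Matrix.of fun x y =>
    -- The general solution of the commutation equations in the three chosen entries. Commuting with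
    -- the first involution separates the span of the index pairs `00`, `11` from that of `01`,
    -- `10`, whence the zeros.
    (![![![![v 0, 0], ![0, v 2]], ![![0, v 1], ![v 0 - v 1 * f / e - v 2, 0]]],
      ![![![0, v 0 - v 1 * f / e - v 2], ![v 1 * f ^ 2 / e ^ 2, 0]], ![![v 2, 0], ![0, v 0]]]] :
      Fin 2 → Fin 2 → Fin 2 → Fin 2 → ℂ) x.1 y.1 x.2 y.2, ?_, ?_⟩
  · rintro X ⟨h1, h2⟩ h3
    rw [← Matrix.ext_iff] at h1 h2
    have h4 : X (0, 0) (0, 0) = 0 := congrFun h3 0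
    have h5 : X (0, 0) (1, 1) = 0 := congrFun h3 1
    have h6 : X (0, 1) (0, 1) = 0 := congrFun h3 2
    clear h3
    simp only [Matrix.mul_apply, Fintype.sum_prod_type, Prod.forall, Fin.forall_fin_two,
      Fin.sum_univ_two, Matrix.kroneckerMap_apply, Matrix.of_apply, Matrix.cons_val] at h1 h2
    rw [← Matrix.ext_iff]
    simp only [Prod.forall, Fin.forall_fin_two, Matrix.zero_apply]
    grind
  -- Substituting `v 1 = g e` removes or lowers the powers of `e` in the denominators.
  · obtain ⟨g, hg⟩ : ∃ g, g = v 1 / e := ⟨_, rfl⟩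
    have hv : v 1 = g * e := by rw [hg]; field_simp
    have e1 : v 1 * f / e = g * f := by rw [hv]; field_simp
    have e2 : v 1 * f ^ 2 / e ^ 2 = g * f ^ 2 / e := by rw [hv]; field_simp
    rw [e1, e2, mem_intertwiners, ← Matrix.ext_iff, ← Matrix.ext_iff]
    simp [Matrix.mul_apply, Fintype.sum_prod_type, Fin.forall_fin_two]
    grind
  · ext k
    fin_cases k <;> simp

/-- The dimension of the space of intertwiners between two products of blocks. -/
def blockHomDim (s t s' t' : Bool) : ℕ :=
  -- The `xor` is the parity of the number of two-dimensional factors. Products of different parity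
  -- share no constituent, and those of equal parity share one, except for two products of two such
  -- factors, which share three.
  if xor s t = xor s' t' then (if s && t && s' && t' then 3 else 1) else 0

theorem finrank_intertwiners_block {c e f : ℂ} (h : e * f = 1 - c ^ 2)
    (he : e ≠ 0) (hf : f ≠ 0) (hc : c ≠ 0) (hc2 : 1 + 2 * c ≠ 0) (s t s' t' : Bool) :
    Module.finrank ℂ (intertwiners (blockL s ⊗ₖ blockL t) (blockR c e f s ⊗ₖ blockR c e f t)
      (blockL s' ⊗ₖ blockL t') (blockR c e f s' ⊗ₖ blockR c e f t')) =
      blockHomDim s t s' t' := by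
  match s, t, s', t' with
  | false, false, false, false => exact finrank_prodHom_triv_triv_triv_triv h he hf
  | false, false, false, true => exact finrank_prodHom_triv_triv_triv_std h he hf
  | false, false, true, false => exact finrank_prodHom_triv_triv_std_triv h he hf
  | false, false, true, true => exact finrank_prodHom_triv_triv_std_std h he hf
  | false, true, false, false => exact finrank_prodHom_triv_std_triv_triv h he hf
  | false, true, false, true => exact finrank_prodHom_triv_std_triv_std h he hf
  | false, true, true, false => exact finrank_prodHom_triv_std_std_triv h he hf
  | false, true, true, true => exact finrank_prodHom_triv_std_std_std h he hf hc2
  | true, false, false, false => exact finrank_prodHom_std_triv_triv_triv h he hf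
  | true, false, false, true => exact finrank_prodHom_std_triv_triv_std h he hf
  | true, false, true, false => exact finrank_prodHom_std_triv_std_triv h he hf
  | true, false, true, true => exact finrank_prodHom_std_triv_std_std h he hf hc2
  | true, true, false, false => exact finrank_prodHom_std_std_triv_triv h he hf
  | true, true, false, true => exact finrank_prodHom_std_std_triv_std h he hf hc2
  | true, true, true, false => exact finrank_prodHom_std_std_std_triv h he hf hc2
  | true, true, true, true => exact finrank_prodHom_std_std_std_std h he hf hc

/-- Among the 36 pairs of blocks, 16 have no two-dimensional factor, 16 have one and 4 have two. The
sum is `16² + 2 · 16 · 4 + 3 · 4²` for even parity plus `16²` for odd parity. -/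
theorem sum_blockHomDim : ∑ x : (Fin 4 ⊕ Fin 2) × (Fin 4 ⊕ Fin 2),
    ∑ y : (Fin 4 ⊕ Fin 2) × (Fin 4 ⊕ Fin 2), blockHomDim (blockKind x.1) (blockKind x.2)
      (blockKind y.1) (blockKind y.2) = 688 := by
  simp [Fintype.sum_prod_type, blockKind, blockHomDim]

/-- The dimension of `O(M_q(X̄))` in degree 3. -/
theorem finrank_component_three_two {q : ℂ} (hq : q ≠ 0) (h1 : q ^ 2 ≠ 1) (h2 : 1 + q ^ 2 ≠ 0)
    (h3 : 1 + q ^ 2 + q ^ 4 ≠ 0) (h4 : 1 + q ^ 4 ≠ 0) :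
    Module.finrank ℂ (component 2 2 q 3) = 688 := by
  have hq2 : q ^ 2 ≠ -1 := fun h => h2 (by linear_combination h)
  rw [finrank_component_three_eq_sum hq hq2 _ _ _ _ (mul_cubeBasisInv h2 h3)
    (cubeBasisInv_mul h2 h3) (ampL_mul_cubeBasis hq hq2) (ampR_mul_cubeBasis hq hq2),
    ← sum_blockHomDim]
  refine Finset.sum_congr rfl fun x _ => Finset.sum_congr rfl fun y _ =>
    finrank_intertwiners_block ?_ ?_ ?_ ?_ ?_ _ _ _ _
  · field_simp
    ring
  · simp [hq, h2]
  · simp [hq, h2, h3]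
  · simp only [ne_eq, div_eq_zero_iff, neg_eq_zero, h4, false_or]
    exact pow_ne_zero 2 h2
  · intro h
    field_simp at h
    -- Clearing denominators in `1 + 2c = 0` leaves this square, so `c = -1/2` forces `q² = 1`.
    have h5 : (q ^ 2 - 1) ^ 2 = 0 := by linear_combination -h
    exact h1 (by linear_combination (pow_eq_zero_iff two_ne_zero).1 h5)

/-! ### The classical case -/

/-- At `q = 1` the involution is the flip of the two factors, which makes the relations those of
commuting variables. -/
theorem involX_one (n m : ℕ) (r c : Idx n m × Idx n m) :
    involX n m 1 r c = if c = (r.2, r.1) then 1 else 0 := by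
  obtain ⟨⟨a, b⟩, ⟨a', b'⟩⟩ := r
  obtain ⟨⟨x, y⟩, ⟨x', y'⟩⟩ := c
  simp only [involX, invol, braiding, Matrix.submatrix_apply, Matrix.kroneckerMap_apply,
    Equiv.prodProdProdComm_apply, Matrix.smul_apply, Matrix.of_apply,
    inv_one, sub_self, zero_mul, add_zero, zero_smul, sub_zero, ite_self, one_mul, smul_eq_mul,
    Prod.mk.injEq]
  norm_num
  by_cases h1 : a = x' <;> by_cases h2 : a' = x <;> by_cases h3 : b = y' <;>
    by_cases h4 : b' = y <;> simp [h1, h2, h3, h4, eq_comm]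

theorem relLeft_one (n m : ℕ) (r c : Idx n m × Idx n m) :
    relLeft n m 1 r c = (2 : ℂ)⁻¹ • (monomial [(r.1, c.1), (r.2, c.2)] +
      monomial [(r.2, c.1), (r.1, c.2)]) := by
  rw [relLeft_apply, projPlus_eq n m one_ne_zero (by norm_num)]
  simp [involX_one, Matrix.one_apply, add_smul, mul_add, Finset.sum_add_distrib]

theorem relRight_one (n m : ℕ) (r c : Idx n m × Idx n m) :
    relRight n m 1 r c = (2 : ℂ)⁻¹ • (monomial [(r.1, c.1), (r.2, c.2)] +
      monomial [(r.1, c.2), (r.2, c.1)]) := by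
  have h : ∀ k : Idx n m × Idx n m, c = (k.2, k.1) ↔ k = (c.2, c.1) := fun k => by
    simp only [Prod.ext_iff]
    tauto
  rw [relRight_apply, projPlus_eq n m one_ne_zero (by norm_num)]
  simp [involX_one, Matrix.one_apply, add_smul, mul_add, Finset.sum_add_distrib, h]

theorem toCoord_one_comm {n m : ℕ} (x y : CoordAlg n m 1) : x * y = y * x := by
  have hgen : ∀ A B : Gen n m, Commute (toCoord n m 1 (FreeAlgebra.ι ℂ A))
      (toCoord n m 1 (FreeAlgebra.ι ℂ B)) := by
    intro A B
    -- With rows in the order `B`, `A` and columns in the order `A`, `B`, the two sides share the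
    -- unswapped monomial; the remaining ones are `A B` and `B A`.
    have h := toCoord_relLeft (1 : ℂ) (B.1, A.1) (A.2, B.2)
    rw [relLeft_one, relRight_one, map_smul, map_smul, smul_right_inj (by norm_num), map_add,
      map_add, add_right_inj] at h
    have h' : toCoord n m 1 (FreeAlgebra.ι ℂ A) * toCoord n m 1 (FreeAlgebra.ι ℂ B) =
        toCoord n m 1 (FreeAlgebra.ι ℂ B) * toCoord n m 1 (FreeAlgebra.ι ℂ A) := by
      simpa [monomial] using h
    exact h'
  have hfree : ∀ x y : Free n m, Commute (toCoord n m 1 x) (toCoord n m 1 y) := by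
    intro x y
    induction x using FreeAlgebra.induction with
    | grade0 r => rw [AlgHom.commutes]; exact Algebra.commutes r _
    | grade1 A =>
      induction y using FreeAlgebra.induction with
      | grade0 r => rw [AlgHom.commutes]; exact (Algebra.commutes r _).symm
      | grade1 B => exact hgen A B
      | mul a b ha hb => rw [map_mul]; exact ha.mul_right hb
      | add a b ha hb => rw [map_add]; exact ha.add_right hb
    | mul a b ha hb => rw [map_mul]; exact ha.mul_left hb
    | add a b ha hb => rw [map_add]; exact ha.add_left hb
  obtain ⟨a, rfl⟩ := toCoord_surjective n m 1 x
  obtain ⟨b, rfl⟩ := toCoord_surjective n m 1 y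
  exact hfree a b

/-- At `q = 1` the coordinate algebra is commutative. -/
@[reducible]
def coordAlgOneCommRing (n m : ℕ) : CommRing (CoordAlg n m 1) :=
  { (inferInstance : Ring (CoordAlg n m 1)) with mul_comm := toCoord_one_comm }

/-- At `q = 1` the coordinate algebra maps to the polynomial ring. -/
def toPolynomial (n m : ℕ) : CoordAlg n m 1 →ₐ[ℂ] MvPolynomial (Gen n m) ℂ :=
  RingQuot.liftAlgHom ℂ ⟨FreeAlgebra.lift ℂ MvPolynomial.X, by
    rintro - - ⟨r, c, rfl, rfl⟩
    rw [relLeft_one, relRight_one, map_smul, map_smul]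
    simp only [monomial, map_add, List.map_cons, List.map_nil, List.prod_cons, List.prod_nil,
      mul_one, map_mul, FreeAlgebra.lift_ι_apply]
    rw [mul_comm (MvPolynomial.X (r.2, c.1))]⟩

theorem toPolynomial_ι {n m : ℕ} (A : Gen n m) :
    toPolynomial n m (toCoord n m 1 (FreeAlgebra.ι ℂ A)) = MvPolynomial.X A := by
  rw [toPolynomial, toCoord, RingQuot.liftAlgHom_mkAlgHom_apply, FreeAlgebra.lift_ι_apply]

/-- Commutativity of the source allows evaluation of polynomials at the generators; this is the
inverse map, because both composites fix the generators. -/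
theorem toPolynomial_bijective (n m : ℕ) : Function.Bijective (toPolynomial n m) := by
  let := coordAlgOneCommRing n m
  let g : MvPolynomial (Gen n m) ℂ →ₐ[ℂ] CoordAlg n m 1 :=
    MvPolynomial.aeval fun A => toCoord n m 1 (FreeAlgebra.ι ℂ A)
  have h1 : g.comp (toPolynomial n m) = AlgHom.id ℂ _ := by
    apply RingQuot.ringQuot_ext'
    apply FreeAlgebra.hom_ext
    funext A
    change g (toPolynomial n m (toCoord n m 1 (FreeAlgebra.ι ℂ A))) =
      toCoord n m 1 (FreeAlgebra.ι ℂ A)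
    rw [toPolynomial_ι, MvPolynomial.aeval_X]
  have h2 : (toPolynomial n m).comp g = AlgHom.id ℂ _ := by
    apply MvPolynomial.algHom_ext
    intro A
    change toPolynomial n m (g (MvPolynomial.X A)) = _
    rw [MvPolynomial.aeval_X, toPolynomial_ι]
    rfl
  exact ⟨Function.LeftInverse.injective (g := g) fun x => DFunLike.congr_fun h1 x,
    Function.RightInverse.surjective (g := g) fun x => DFunLike.congr_fun h2 x⟩

theorem map_component_one (n m d : ℕ) :
    (component n m 1 d).map (toPolynomial n m).toLinearMap =
      MvPolynomial.homogeneousSubmodule (Gen n m) ℂ d := by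
  rw [component, Submodule.map_pow, Submodule.map_span, ← MvPolynomial.homogeneousSubmodule_one_pow,
    MvPolynomial.homogeneousSubmodule_one_eq_span_X, ← Set.range_comp]
  congr 3
  funext A
  exact toPolynomial_ι A

theorem poincareSeries_one (n m : ℕ) : poincareSeries n m 1 = classicalPoincareSeries n m := by
  rw [poincareSeries, classicalPoincareSeries]
  congr 1
  funext d
  rw [← map_component_one]
  exact (LinearEquiv.finrank_eq (Submodule.equivMapOfInjective _
    (toPolynomial_bijective n m).1 _))

theorem finrank_homogeneousSubmodule (σ : Type*) [Fintype σ] [DecidableEq σ] (d : ℕ) :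
    Module.finrank ℂ (MvPolynomial.homogeneousSubmodule σ ℂ d) =
      (Fintype.card σ).multichoose d := by
  have hmem : ∀ e : σ →₀ ℕ, e ∈ Finset.univ.finsuppAntidiag d ↔ e.degree = d := by
    intro e
    simp [Finset.mem_finsuppAntidiag, Finsupp.degree_eq_sum]
  have hli : LinearIndependent ℂ fun e : (Finset.univ : Finset σ).finsuppAntidiag d =>
      (MvPolynomial.monomial (e : σ →₀ ℕ) (1 : ℂ)) := by
    have := (MvPolynomial.basisMonomials σ ℂ).linearIndependent.comp
      (fun e : (Finset.univ : Finset σ).finsuppAntidiag d => (e : σ →₀ ℕ))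
      Subtype.val_injective
    rwa [MvPolynomial.coe_basisMonomials] at this
  have hspan : MvPolynomial.homogeneousSubmodule σ ℂ d = Submodule.span ℂ (Set.range
      fun e : (Finset.univ : Finset σ).finsuppAntidiag d =>
        (MvPolynomial.monomial (e : σ →₀ ℕ) (1 : ℂ))) := by
    rw [MvPolynomial.homogeneousSubmodule_eq_finsupp_supported,
      AddMonoidAlgebra.supported_eq_span_single]
    congr 1
    ext p
    simp [MvPolynomial.single_eq_monomial, hmem]
  rw [hspan, finrank_span_eq_card hli, Fintype.card_coe,
    Finset.card_finsuppAntidiag_nat_eq_multichoose, Finset.card_univ]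

/-! ### Existence and uniqueness of the rules -/

theorem invol_apply (n : ℕ) {q : ℂ} (hq : q ≠ 0) (hq2 : q ^ 2 ≠ -1) (i j : Fin n)
    (c : Fin n × Fin n) : invol n q (i, j) c =
      if i = j then (if c = (i, i) then 1 else 0) else
        (if c = (i, j) then (q + q⁻¹)⁻¹ * (if i < j then q - q⁻¹ else -(q - q⁻¹)) else 0) +
        (if c = (j, i) then 2 * (q + q⁻¹)⁻¹ else 0) := by
  have hb := add_inv_ne_zero hq hq2
  have h1 : 1 + q ^ 2 ≠ 0 := fun h => hq2 (by linear_combination h)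
  have h2 : q ^ 2 + 1 ≠ 0 := by rwa [add_comm]
  by_cases hij : i = j
  · subst hij
    by_cases hc : c = (i, i)
    · subst hc
      simp only [invol, braiding, Matrix.smul_apply, Matrix.sub_apply, Matrix.of_apply,
        Matrix.one_apply_eq, smul_eq_mul, if_true, and_self, lt_irrefl, and_false, if_false]
      field_simp
      ring
    · have hc' : ¬ (i = c.2 ∧ i = c.1) := fun h => hc (Prod.ext h.2.symm h.1.symm)
      simp [invol, braiding, Matrix.one_apply_ne (Ne.symm hc), hc, hc']
  · by_cases hc : c = (i, j)
    · subst hc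
      have hc' : ¬ (i, j) = (j, i) := fun h => hij (Prod.ext_iff.1 h).1
      by_cases h : i < j <;> simp [invol, braiding, hij, hc', h]
      exact Or.inl (by ring)
    · by_cases hc' : c = (j, i)
      · subst hc'
        have h' : ¬ (i, j) = (j, i) := fun h => hij (Prod.ext_iff.1 h).1
        simp [invol, braiding, Matrix.one_apply_ne h', hij, mul_comm]
      · have h3 : ¬ (i = c.2 ∧ j = c.1) := fun h => hc' (Prod.ext h.2.symm h.1.symm)
        have h4 : ¬ (i = c.1 ∧ j = c.2 ∧ i < j) := fun h =>
          hc (Prod.ext h.1.symm h.2.1.symm)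
        simp [invol, braiding, Matrix.one_apply_ne (Ne.symm hc), hc, hc', h3, h4, hij]

theorem braiding_symm (n : ℕ) (q : ℂ) (r c : Fin n × Fin n) :
    braiding n q r c = braiding n q c r := by
  obtain ⟨i, j⟩ := r
  obtain ⟨k, l⟩ := c
  by_cases h1 : i = k <;> by_cases h2 : j = l <;> by_cases h3 : i = l <;> by_cases h4 : j = k <;>
    simp_all [braiding, eq_comm]

theorem involX_symm (n m : ℕ) (q : ℂ) (r c : Idx n m × Idx n m) :
    involX n m q r c = involX n m q c r := by
  have h : ∀ k (a b : Fin k × Fin k), invol k q a b = invol k q b a := fun k a b => by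
    simp [invol, braiding_symm k q a b, Matrix.one_apply, eq_comm]
  simp [involX, h n (r.1.1, r.2.1), h m (r.1.2, r.2.2)]

theorem involX_mulVec (n m : ℕ) (q : ℂ) (g : Idx n m × Idx n m → ℂ) (x₁ y₁ : Fin n)
    (x₂ y₂ : Fin m) : (involX n m q).mulVec g ((x₁, x₂), (y₁, y₂)) =
      ∑ a, invol n q (x₁, y₁) a * ∑ b, invol m q (x₂, y₂) b * g ((a.1, b.1), (a.2, b.2)) := by
  rw [Matrix.mulVec, dotProduct,
    ← (Equiv.prodProdProdComm (Fin n) (Fin n) (Fin m) (Fin m)).sum_comp, Fintype.sum_prod_type]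
  simp [involX, Finset.mul_sum, mul_assoc]

theorem involX_mulVec_diag (n m : ℕ) {q : ℂ} (hq : q ≠ 0) (hq2 : q ^ 2 ≠ -1)
    (g : Idx n m × Idx n m → ℂ) (x : Idx n m) : (involX n m q).mulVec g (x, x) = g (x, x) := by
  obtain ⟨x₁, x₂⟩ := x
  rw [involX_mulVec]
  simp [invol_apply _ hq hq2]

/-- A set of vectors stable under the involution, all of which vanish at one of any two
transposed off-diagonal places, vanishes off the diagonal. -/
theorem eq_zero_of_stable {n m : ℕ} {q : ℂ} (hq : q ≠ 0) (hq2 : q ^ 2 ≠ -1)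
    (ltn : Fin n → Fin n → Prop) (ltm : Fin m → Fin m → Prop)
    (hn : ∀ i j, i ≠ j → ltn i j ∨ ltn j i) (hm : ∀ i j, i ≠ j → ltm i j ∨ ltm j i)
    (W : Set (Idx n m × Idx n m → ℂ)) (hW : ∀ g ∈ W, (involX n m q).mulVec g ∈ W)
    (h1 : ∀ g ∈ W, ∀ x₁ x₂ y₁ y₂, ltn x₁ y₁ → g ((x₁, x₂), (y₁, y₂)) = 0)
    (h2 : ∀ g ∈ W, ∀ x₁ x₂ y₂, ltm x₂ y₂ → g ((x₁, x₂), (x₁, y₂)) = 0)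
    (g : Idx n m × Idx n m → ℂ) (hg : g ∈ W) (x y : Idx n m) (hxy : x ≠ y) : g (x, y) = 0 := by
  have hb := inv_ne_zero (add_inv_ne_zero hq hq2)
  obtain ⟨x₁, x₂⟩ := x
  obtain ⟨y₁, y₂⟩ := y
  by_cases h : x₁ = y₁
  · subst h
    have hne : x₂ ≠ y₂ := fun h => hxy (by rw [h])
    rcases hm _ _ hne with h | h
    · exact h2 g hg _ _ _ h
    -- The image of `g` also vanishes at the transposed place. Its value there combines the entries
    -- of `g` at the two places, and the entry sought has coefficient `2 / (q + q⁻¹)`.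
    · have h3 := h2 _ (hW g hg) x₁ _ _ h
      rw [involX_mulVec] at h3
      simpa [invol_apply _ hq hq2, hne.symm, add_mul, Finset.sum_add_distrib, h2 g hg _ _ _ h,
        hb] using h3
  · rcases hn _ _ h with h' | h'
    · exact h1 g hg _ _ _ _ h'
    -- Vanishing of the image at all places with first indices `y₁`, `x₁` says that the involution
    -- of the second factor kills a whole slice of `g`; being invertible, it can be removed.
    · have h3 : (invol m q).mulVec (fun b => g ((x₁, b.1), (y₁, b.2))) = 0 := by
        ext ⟨u, v⟩
        have h4 := h1 _ (hW g hg) y₁ u x₁ v h'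
        rw [involX_mulVec] at h4
        simpa [invol_apply n hq hq2, Ne.symm h, add_mul, Finset.sum_add_distrib,
          h1 g hg _ _ _ _ h', hb, Matrix.mulVec, dotProduct] using h4
      have h5 := congrArg (invol m q).mulVec h3
      rw [Matrix.mulVec_mulVec, invol_mul_self m hq hq2, Matrix.one_mulVec,
        Matrix.mulVec_zero] at h5
      exact congrFun h5 (x₂, y₂)

/-- A matrix that commutes or anticommutes with the involution vanishes if it vanishes at all
nonstandard, or at all standard monomials. -/
theorem eq_zero_of_intertwines {n m : ℕ} {q : ℂ} (hq : q ≠ 0) (hq2 : q ^ 2 ≠ -1)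
    (ltn : Fin n → Fin n → Prop) (ltm : Fin m → Fin m → Prop)
    (hn : ∀ i j, i ≠ j → ltn i j ∨ ltn j i) (hm : ∀ i j, i ≠ j → ltm i j ∨ ltm j i)
    (φ : Matrix (Idx n m × Idx n m) (Idx n m × Idx n m) ℂ) (μ : ℂ) (hμ : μ ≠ 0)
    (hφ : involX n m q * φ = μ • (φ * involX n m q))
    (h1 : ∀ x₁ x₂ y₁ y₂ c, ltn x₁ y₁ → φ ((x₁, x₂), (y₁, y₂)) c = 0)
    (h2 : ∀ x₁ x₂ y₂ c, ltm x₂ y₂ → φ ((x₁, x₂), (x₁, y₂)) c = 0)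
    (h3 : ∀ x k₁ k₂ l₁ l₂, ltn k₁ l₁ → φ (x, x) ((k₁, k₂), (l₁, l₂)) = 0)
    (h4 : ∀ x k₁ k₂ l₂, ltm k₂ l₂ → φ (x, x) ((k₁, k₂), (k₁, l₂)) = 0)
    (h5 : ∀ x k, φ (x, x) (k, k) = 0) : φ = 0 := by
  have hcol : ∀ x y c, x ≠ y → φ (x, y) c = 0 := by
    intro x y c hxy
    -- Intertwining makes the column space of `φ` stable under the involution, which settles all
    -- off-diagonal row pairs.
    have := eq_zero_of_stable hq hq2 ltn ltm hn hm (Set.range φ.mulVec) (by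
        rintro - ⟨v, rfl⟩
        refine ⟨μ • (involX n m q).mulVec v, ?_⟩
        rw [Matrix.mulVec_smul, Matrix.mulVec_mulVec, Matrix.mulVec_mulVec, hφ,
          Matrix.smul_mulVec]) (by
        rintro - ⟨v, rfl⟩ x₁ x₂ y₁ y₂ h
        simp [Matrix.mulVec, dotProduct, h1 _ _ _ _ _ h]) (by
        rintro - ⟨v, rfl⟩ x₁ x₂ y₂ h
        simp [Matrix.mulVec, dotProduct, h2 _ _ _ _ h])
        (φ.mulVec (Pi.single c 1)) ⟨_, rfl⟩ x y hxy
    simpa using this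
  -- The involution fixes `x ⊗ x`, so the row of `φ` at `(x, x)` is an eigenvector of the
  -- involution, and the vanishing criterion applies to its multiples.
  have hrow : ∀ x, (involX n m q).mulVec (φ (x, x)) = μ⁻¹ • φ (x, x) := by
    intro x
    ext c
    have h6 := congrFun (congrFun hφ (x, x)) c
    have h7 : (involX n m q * φ) (x, x) c = φ (x, x) c :=
      involX_mulVec_diag n m hq hq2 (fun r => φ r c) x
    have h8 : (φ * involX n m q) (x, x) c = (involX n m q).mulVec (φ (x, x)) c := by
      rw [Matrix.mul_apply, Matrix.mulVec, dotProduct]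
      exact Finset.sum_congr rfl fun k _ => by rw [involX_symm, mul_comm]
    rw [h7, Matrix.smul_apply, h8, smul_eq_mul] at h6
    rw [Pi.smul_apply, smul_eq_mul, h6, inv_mul_cancel_left₀ hμ]
  ext ⟨x, y⟩ ⟨k, l⟩
  by_cases hxy : x = y
  · subst hxy
    by_cases hkl : k = l
    · subst hkl
      exact h5 x k
    · refine eq_zero_of_stable hq hq2 ltn ltm hn hm {g | ∃ a : ℂ, g = a • φ (x, x)} ?_ ?_ ?_
        _ ⟨1, (one_smul _ _).symm⟩ k l hkl
      · rintro - ⟨a, rfl⟩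
        exact ⟨a * μ⁻¹, by rw [Matrix.mulVec_smul, hrow, smul_smul]⟩
      · rintro - ⟨a, rfl⟩ k₁ k₂ l₁ l₂ h
        simp [h3 _ _ _ _ _ h]
      · rintro - ⟨a, rfl⟩ k₁ k₂ l₂ h
        simp [h4 _ _ _ _ h]
  · exact hcol x y _ hxy

theorem isStandard_pair {n m : ℕ} {A B : Gen n m} :
    IsStandard [A, B] ↔ lexKey B ≤ lexKey A := by
  simp [IsStandard]

theorem lexKey_lt_iff {n m : ℕ} {A B : Gen n m} : lexKey A < lexKey B ↔
    A.1.1 < B.1.1 ∨ A.1.1 = B.1.1 ∧ (A.1.2 < B.1.2 ∨ A.1.2 = B.1.2 ∧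
      (A.2.1 < B.2.1 ∨ A.2.1 = B.2.1 ∧ A.2.2 < B.2.2)) := by
  simp [lexKey, Prod.Lex.toLex_lt_toLex]

/-- By duality: a functional killing the relations and the standard monomials gives a matrix
commuting with the involution and zero at standard places, hence zero everywhere. -/
theorem monomial_mem_sup {n m : ℕ} {q : ℂ} (hq : q ≠ 0) (hq2 : q ^ 2 ≠ -1) (A B : Gen n m) :
    monomial [A, B] ∈ relSpan n m q ⊔ standardSpan n m 2 := by
  by_contra hAB
  obtain ⟨f, hf, hle⟩ := Submodule.exists_le_ker_of_notMem hAB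
  rw [sup_le_iff] at hle
  have hrel := (map_relLeft_eq_iff hq hq2 f).1 fun r c => by
    rw [← sub_eq_zero, ← map_sub]
    exact hle.1 (Submodule.subset_span ⟨r, c, rfl⟩)
  have hstd : ∀ r c : Idx n m × Idx n m, lexKey (r.2, c.2) ≤ lexKey (r.1, c.1) →
      f (monomial (pairWord r c)) = 0 := fun r c h =>
    hle.2 (Submodule.subset_span ⟨_, rfl, isStandard_pair.2 h, rfl⟩)
  -- The order is reversed here, since a pair with decreasing labels is the standard one.
  have h0 := eq_zero_of_intertwines hq hq2 (fun i j => j < i) (fun i j => j < i)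
    (fun _ _ h => lt_or_gt_of_ne h.symm) (fun _ _ h => lt_or_gt_of_ne h.symm)
    (Matrix.of fun r c => f (monomial (pairWord r c))) 1 one_ne_zero
    (by rw [one_smul]; exact hrel)
    (fun x₁ x₂ y₁ y₂ c h => hstd _ _ (lexKey_lt_iff.2 (by simp [h])).le)
    (fun x₁ x₂ y₂ c h => hstd _ _ (lexKey_lt_iff.2 (by simp [h])).le)
    (fun x k₁ k₂ l₁ l₂ h => hstd _ _ (lexKey_lt_iff.2 (by simp [h])).le)
    (fun x k₁ k₂ l₂ h => hstd _ _ (lexKey_lt_iff.2 (by simp [h])).le)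
    (fun x k => hstd _ _ le_rfl)
  exact hf (congrFun (congrFun h0 (A.1, B.1)) (A.2, B.2))

/-- The coefficients of the quadratic monomials. -/
def pairCoeff (n m : ℕ) :
    Free n m →ₗ[ℂ] Matrix (Idx n m × Idx n m) (Idx n m × Idx n m) ℂ :=
  wordLift fun w => match w with
    | [A, B] => Matrix.single (A.1, B.1) (A.2, B.2) 1
    | _ => 0

theorem pairCoeff_pair {n m : ℕ} (A B : Gen n m) :
    pairCoeff n m (monomial [A, B]) = Matrix.single (A.1, B.1) (A.2, B.2) 1 := by
  rw [pairCoeff, wordLift_monomial]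

theorem eq_sum_pairCoeff {n m : ℕ} {f : Free n m} (hf : f ∈ standardSpan n m 2) :
    f = ∑ r, ∑ c, pairCoeff n m f r c • monomial (pairWord r c) := by
  induction hf using Submodule.span_induction with
  | mem f h =>
    obtain ⟨w, hw, -, rfl⟩ := h
    obtain ⟨A, B, rfl⟩ := List.length_eq_two.1 hw
    rw [pairCoeff_pair, Finset.sum_eq_single (A.1, B.1), Finset.sum_eq_single (A.2, B.2)]
    · simp [pairWord]
    · intro c _ hc
      simp [hc.symm]
    · simp
    · intro r _ hr
      simp [hr.symm]
    · simp
  | zero => simp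
  | add f g _ _ hf hg =>
    simp only [map_add, Matrix.add_apply, add_smul, Finset.sum_add_distrib, ← hf, ← hg]
  | smul a f _ hf =>
    simp only [map_smul, Matrix.smul_apply, smul_assoc, ← Finset.smul_sum, ← hf]

/-- The coefficients of a relation form half the commutator of `S` with a matrix unit, `S` being
symmetric, and a commutator with an involution anticommutes with it. -/
theorem pairCoeff_relSpan {n m : ℕ} {q : ℂ} (hq : q ≠ 0) (hq2 : q ^ 2 ≠ -1) {f : Free n m}
    (hf : f ∈ relSpan n m q) :
    involX n m q * pairCoeff n m f = (-1 : ℂ) • (pairCoeff n m f * involX n m q) := by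
  have hS := involX_mul_self n m hq hq2
  induction hf using Submodule.span_induction with
  | mem f h =>
    obtain ⟨r, c, rfl⟩ := h
    have hs : ∀ a b, projPlus n m q a b = projPlus n m q b a := fun a b => by
      rw [projPlus_eq n m hq hq2]
      simp [involX_symm n m q a b, Matrix.one_apply, eq_comm]
    have hL : pairCoeff n m (relLeft n m q r c) = projPlus n m q * Matrix.single r c 1 := by
      rw [relLeft_apply, map_sum]
      simp only [map_smul, pairCoeff_pair]
      ext a b
      simp only [Matrix.sum_apply, Matrix.smul_apply, Matrix.single_apply, Matrix.mul_apply]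
      rw [Finset.sum_eq_single a, Finset.sum_eq_single r]
      · simp [hs r a]
      · intro k _ hk; simp [hk.symm]
      · simp
      · intro k _ hk; simp [hk]
      · simp
    have hR : pairCoeff n m (relRight n m q r c) = Matrix.single r c 1 * projPlus n m q := by
      rw [relRight_apply, map_sum]
      simp only [map_smul, pairCoeff_pair]
      ext a b
      simp only [Matrix.sum_apply, Matrix.smul_apply, Matrix.single_apply, Matrix.mul_apply]
      rw [Finset.sum_eq_single b, Finset.sum_eq_single c]
      · simp [hs b c]
      · intro k _ hk; simp [hk.symm]
      · simp
      · intro k _ hk; simp [hk]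
      · simp
    rw [map_sub, hL, hR, projPlus_eq n m hq hq2]
    generalize Matrix.single r c (1 : ℂ) = E
    simp only [smul_mul_assoc, mul_smul_comm, add_mul, mul_add, one_mul, mul_one, mul_sub, sub_mul,
      ← mul_assoc, hS]
    rw [mul_assoc E, hS, mul_one]
    module
  | zero => simp
  | add f g _ _ hf hg => rw [map_add, mul_add, add_mul, hf, hg, smul_add]
  | smul a f _ hf => rw [map_smul, mul_smul_comm, smul_mul_assoc, hf, smul_comm]

theorem pairCoeff_standardSpan {n m : ℕ} {f : Free n m} (hf : f ∈ standardSpan n m 2)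
    (r c : Idx n m × Idx n m) (h : lexKey (r.1, c.1) < lexKey (r.2, c.2)) :
    pairCoeff n m f r c = 0 := by
  induction hf using Submodule.span_induction with
  | mem f h' =>
    obtain ⟨w, hw, hs, rfl⟩ := h'
    obtain ⟨A, B, rfl⟩ := List.length_eq_two.1 hw
    rw [pairCoeff_pair, Matrix.single_apply, if_neg]
    rintro ⟨rfl, rfl⟩
    exact h.not_ge (isStandard_pair.1 hs)
  | zero => simp
  | add f g _ _ hf hg => rw [map_add, Matrix.add_apply, hf, hg, add_zero]
  | smul a f _ hf => rw [map_smul, Matrix.smul_apply, hf, smul_zero]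

/-- The coefficient matrix anticommutes with the involution and is supported on standard places,
which is the other use of the vanishing statement. -/
theorem eq_zero_of_mem_relSpan_of_mem_standardSpan {n m : ℕ} {q : ℂ} (hq : q ≠ 0)
    (hq2 : q ^ 2 ≠ -1) {f : Free n m} (hr : f ∈ relSpan n m q) (hs : f ∈ standardSpan n m 2) :
    f = 0 := by
  have hanti := pairCoeff_relSpan hq hq2 hr
  have hstd := pairCoeff_standardSpan hs
  have h0 := eq_zero_of_intertwines hq hq2 (fun i j => i < j) (fun i j => i < j)
    (fun _ _ h => lt_or_gt_of_ne h) (fun _ _ h => lt_or_gt_of_ne h) (pairCoeff n m f) (-1)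
    (by norm_num) hanti
    (fun x₁ x₂ y₁ y₂ c h => hstd _ _ (lexKey_lt_iff.2 (by simp [h])))
    (fun x₁ x₂ y₂ c h => hstd _ _ (lexKey_lt_iff.2 (by simp [h])))
    (fun x k₁ k₂ l₁ l₂ h => hstd _ _ (lexKey_lt_iff.2 (by simp [h])))
    (fun x k₁ k₂ l₂ h => hstd _ _ (lexKey_lt_iff.2 (by simp [h])))
    -- Places `(x, x), (k, k)` are standard, so support says nothing about them; but the involution
    -- fixes these vectors on both sides, and anticommutation makes the entry its own negative.
    (fun x k => by
      have h1 := congrFun (congrFun hanti (x, x)) (k, k)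
      have h2 : (involX n m q * pairCoeff n m f) (x, x) (k, k) = pairCoeff n m f (x, x) (k, k) :=
        involX_mulVec_diag n m hq hq2 (fun r => pairCoeff n m f r (k, k)) x
      have h3 : (pairCoeff n m f * involX n m q) (x, x) (k, k) =
          pairCoeff n m f (x, x) (k, k) := by
        rw [← involX_mulVec_diag n m hq hq2 (pairCoeff n m f (x, x)) k, Matrix.mul_apply,
          Matrix.mulVec, dotProduct]
        exact Finset.sum_congr rfl fun l _ => by rw [involX_symm, mul_comm]
      rw [h2, Matrix.smul_apply, h3, smul_eq_mul] at h1
      linear_combination h1 / 2)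
  rw [eq_sum_pairCoeff hs, h0]
  simp

/-- There is exactly one rule for each nonstandard quadratic monomial. -/
theorem existsUnique_isRule {n m : ℕ} {q : ℂ} (hq : q ≠ 0) (hq2 : q ^ 2 ≠ -1) (A B : Gen n m)
    (hAB : ¬ IsStandard [A, B]) : ∃! f, IsRule q A B f := by
  obtain ⟨g, hg, f, hf, hgf⟩ := Submodule.mem_sup.1 (monomial_mem_sup hq hq2 A B)
  refine ⟨f, ⟨hAB, hf, ?_⟩, ?_⟩
  · rwa [← hgf, add_sub_cancel_right]
  · rintro f' ⟨-, hf', hr⟩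
    refine sub_eq_zero.1 (eq_zero_of_mem_relSpan_of_mem_standardSpan hq hq2 ?_
      (Submodule.sub_mem _ hf' hf))
    have : f' - f = g - (monomial [A, B] - f') := by rw [← hgf]; abel
    rw [this]
    exact Submodule.sub_mem _ hg hr

/-! ### Explicit rules -/

/-- The entry at `(r, c)` of `S (u ⊗ u) - (u ⊗ u) S`, where `S` is the involution `involX`. -/
def involRel (q : ℂ) (r c : Idx 2 2 × Idx 2 2) : Free 2 2 :=
  ∑ k, involX 2 2 q r k • monomial (pairWord k c) -
    ∑ k, involX 2 2 q c k • monomial (pairWord r k)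

theorem involRel_mem_relSpan {q : ℂ} (hq : q ≠ 0) (hq2 : q ^ 2 ≠ -1) (r c : Idx 2 2 × Idx 2 2) :
    involRel q r c ∈ relSpan 2 2 q := by
  have h : involRel q r c = (2 : ℂ) • (relLeft 2 2 q r c - relRight 2 2 q r c) := by
    rw [relLeft_apply, relRight_apply, projPlus_eq 2 2 hq hq2, involRel]
    simp only [Matrix.smul_apply, Matrix.add_apply, smul_add, add_smul, smul_assoc,
      Finset.sum_add_distrib, ← Finset.smul_sum, Matrix.one_apply, ite_smul, one_smul, zero_smul,
      Finset.sum_ite_eq, Finset.sum_ite_eq', Finset.mem_univ, if_true, pairWord]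
    simp only [involX_symm 2 2 q c]
    module
  rw [h]
  exact Submodule.smul_mem _ _ (Submodule.subset_span ⟨r, c, rfl⟩)

theorem smul_involRel_mem {q : ℂ} (hq : q ≠ 0) (hq2 : q ^ 2 ≠ -1) (a : ℂ)
    (r c : Idx 2 2 × Idx 2 2) : a • involRel q r c ∈ relSpan 2 2 q :=
  Submodule.smul_mem _ _ (involRel_mem_relSpan hq hq2 r c)

/-- The coefficient of `v_j ⊗ v_i` in the image of `v_i ⊗ v_j` under the involution. -/
def offCoeff (q : ℂ) : ℂ := 2 * q / (1 + q ^ 2)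

/-- The coefficient of `v_i ⊗ v_j` in the image of `v_i ⊗ v_j` under the involution. -/
def diagCoeff (q : ℂ) (i j : Fin 2) : ℂ :=
  if i < j then (q ^ 2 - 1) / (1 + q ^ 2) else -((q ^ 2 - 1) / (1 + q ^ 2))

theorem sum_invol_smul {q : ℂ} (hq : q ≠ 0) (hq2 : q ^ 2 ≠ -1) {M : Type*} [AddCommGroup M]
    [Module ℂ M] (F : Fin 2 × Fin 2 → M) (i j : Fin 2) :
    ∑ a, invol 2 q (i, j) a • F a =
      if i = j then F (i, i) else diagCoeff q i j • F (i, j) + offCoeff q • F (j, i) := by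
  fin_cases i <;> fin_cases j <;>
    simp [invol_two hq hq2, Fintype.sum_prod_type, diagCoeff, offCoeff]
  exact add_comm _ _

theorem sum_involX_smul {q : ℂ} (hq : q ≠ 0) (hq2 : q ^ 2 ≠ -1) {M : Type*} [AddCommGroup M]
    [Module ℂ M] (F : Idx 2 2 × Idx 2 2 → M) (x₁ x₂ y₁ y₂ : Fin 2) :
    ∑ k, involX 2 2 q ((x₁, x₂), (y₁, y₂)) k • F k =
      if x₁ = y₁ then
        if x₂ = y₂ then F ((x₁, x₂), (x₁, x₂)) else
          diagCoeff q x₂ y₂ • F ((x₁, x₂), (x₁, y₂)) + offCoeff q • F ((x₁, y₂), (x₁, x₂))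
      else
        if x₂ = y₂ then
          diagCoeff q x₁ y₁ • F ((x₁, x₂), (y₁, x₂)) + offCoeff q • F ((y₁, x₂), (x₁, x₂))
        else diagCoeff q x₁ y₁ • (diagCoeff q x₂ y₂ • F ((x₁, x₂), (y₁, y₂)) +
            offCoeff q • F ((x₁, y₂), (y₁, x₂))) +
          offCoeff q • (diagCoeff q x₂ y₂ • F ((y₁, x₂), (x₁, y₂)) +
            offCoeff q • F ((y₁, y₂), (x₁, x₂))) := by
  have h : ∑ k, involX 2 2 q ((x₁, x₂), (y₁, y₂)) k • F k =
      ∑ a, invol 2 q (x₁, y₁) a • ∑ b, invol 2 q (x₂, y₂) b • F ((a.1, b.1), (a.2, b.2)) := by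
    rw [← (Equiv.prodProdProdComm (Fin 2) (Fin 2) (Fin 2) (Fin 2)).sum_comp,
      Fintype.sum_prod_type]
    simp [involX, Finset.smul_sum, mul_smul]
  simp only [h, sum_invol_smul hq hq2]
  split_ifs <;> simp_all

theorem monomial_mem_standardSpan {n m : ℕ} {w : List (Gen n m)} {d : ℕ} (hd : w.length = d)
    (hw : w.IsChain fun A B => ¬ (A.1.1 < B.1.1 ∨ A.1.1 = B.1.1 ∧ (A.1.2 < B.1.2 ∨
      A.1.2 = B.1.2 ∧ (A.2.1 < B.2.1 ∨ A.2.1 = B.2.1 ∧ A.2.2 < B.2.2)))) (a : ℂ) :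
    a • monomial w ∈ standardSpan n m d := by
  refine Submodule.smul_mem _ _ (Submodule.subset_span ⟨w, hd, ?_, rfl⟩)
  simp only [← lexKey_lt_iff, not_lt] at hw
  let : IsTrans (Gen n m) fun A B => lexKey B ≤ lexKey A := ⟨fun _ _ _ h k => k.trans h⟩
  exact List.isChain_iff_pairwise.1 hw

theorem isRule_of_eq {n m : ℕ} {q : ℂ} {A B : Gen n m} {f x : Free n m}
    (hAB : A.1.1 < B.1.1 ∨ A.1.1 = B.1.1 ∧ (A.1.2 < B.1.2 ∨
      A.1.2 = B.1.2 ∧ (A.2.1 < B.2.1 ∨ A.2.1 = B.2.1 ∧ A.2.2 < B.2.2)))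
    (hf : f ∈ standardSpan n m 2) (hx : x ∈ relSpan n m q) (h : monomial [A, B] - f = x) :
    IsRule q A B f :=
  ⟨by rwa [isStandard_pair, not_le, lexKey_lt_iff], hf, h ▸ hx⟩

/-- Each explicit rule is certified by writing monomial minus replacement as a combination of
entries of `S (u ⊗ u) - (u ⊗ u) S` with one fixed pair of rows; the multipliers solve a small linear
system. For equal rows the left operator is the identity, and only the column indices are exchanged.
-/
theorem isRule_1111_1112 {q : ℂ} (hq : q ≠ 0) (hq2 : q ^ 2 ≠ -1) :
    IsRule q (lab 0 0 0 0) (lab 0 0 0 1) (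
      q • monomial [lab 0 0 0 1, lab 0 0 0 0]) := by
  have h : 1 + q ^ 2 ≠ 0 := fun h => hq2 (by linear_combination h)
  have h' : q ^ 2 + 1 ≠ 0 := by rwa [add_comm]
  refine isRule_of_eq (x :=
      ((q ^ 2 + 1) / 2) • involRel q ((0, 0), (0, 0)) ((0, 0), (0, 1))) (by decide) ?_ ?_ ?_
  · exact monomial_mem_standardSpan (by rfl) (by decide) _
  · exact smul_involRel_mem hq hq2 _ _ _
  · simp [involRel, sum_involX_smul hq hq2, pairWord, diagCoeff, offCoeff]
    match_scalars <;> field_simp <;> ring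

theorem isRule_1111_1121 {q : ℂ} (hq : q ≠ 0) (hq2 : q ^ 2 ≠ -1) :
    IsRule q (lab 0 0 0 0) (lab 0 0 1 0) (
      q • monomial [lab 0 0 1 0, lab 0 0 0 0]) := by
  have h : 1 + q ^ 2 ≠ 0 := fun h => hq2 (by linear_combination h)
  have h' : q ^ 2 + 1 ≠ 0 := by rwa [add_comm]
  refine isRule_of_eq (x :=
      ((q ^ 2 + 1) / 2) • involRel q ((0, 0), (0, 0)) ((0, 0), (1, 0))) (by decide) ?_ ?_ ?_
  · exact monomial_mem_standardSpan (by rfl) (by decide) _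
  · exact smul_involRel_mem hq hq2 _ _ _
  · simp [involRel, sum_involX_smul hq hq2, pairWord, diagCoeff, offCoeff]
    match_scalars <;> field_simp <;> ring

theorem isRule_1111_1122 {q : ℂ} (hq : q ≠ 0) (hq2 : q ^ 2 ≠ -1) :
    IsRule q (lab 0 0 0 0) (lab 0 0 1 1) (
      (1 : ℂ) • monomial [lab 0 0 1 1, lab 0 0 0 0] +
      ((q ^ 2 - 1) / q) • monomial [lab 0 0 1 0, lab 0 0 0 1]) := by
  have h : 1 + q ^ 2 ≠ 0 := fun h => hq2 (by linear_combination h)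
  have h' : q ^ 2 + 1 ≠ 0 := by rwa [add_comm]
  refine isRule_of_eq (x :=
      ((q ^ 4 + 1) / (2 * q ^ 2)) • involRel q ((0, 0), (0, 0)) ((0, 0), (1, 1)) +
      ((q ^ 2 - 1) / (2 * q)) • involRel q ((0, 0), (0, 0)) ((0, 1), (1, 0))) (by decide) ?_ ?_ ?_
  · exact Submodule.add_mem _ (monomial_mem_standardSpan (by rfl) (by decide) _)
      (monomial_mem_standardSpan (by rfl) (by decide) _)
  · exact Submodule.add_mem _ (smul_involRel_mem hq hq2 _ _ _)
      (smul_involRel_mem hq hq2 _ _ _)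
  · simp [involRel, sum_involX_smul hq hq2, pairWord, diagCoeff, offCoeff]
    match_scalars <;> field_simp <;> ring

theorem isRule_1112_1121 {q : ℂ} (hq : q ≠ 0) (hq2 : q ^ 2 ≠ -1) :
    IsRule q (lab 0 0 0 1) (lab 0 0 1 0) (
      (1 : ℂ) • monomial [lab 0 0 1 0, lab 0 0 0 1]) := by
  have h : 1 + q ^ 2 ≠ 0 := fun h => hq2 (by linear_combination h)
  have h' : q ^ 2 + 1 ≠ 0 := by rwa [add_comm]
  refine isRule_of_eq (x :=
      ((q ^ 2 - 1) / (2 * q)) • involRel q ((0, 0), (0, 0)) ((0, 0), (1, 1)) +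
      (1 : ℂ) • involRel q ((0, 0), (0, 0)) ((0, 1), (1, 0))) (by decide) ?_ ?_ ?_
  · exact monomial_mem_standardSpan (by rfl) (by decide) _
  · exact Submodule.add_mem _ (smul_involRel_mem hq hq2 _ _ _)
      (smul_involRel_mem hq hq2 _ _ _)
  · simp [involRel, sum_involX_smul hq hq2, pairWord, diagCoeff, offCoeff]
    match_scalars <;> field_simp <;> ring

theorem isRule_1111_1211 {q : ℂ} (hq : q ≠ 0) (hq2 : q ^ 2 ≠ -1) :
    IsRule q (lab 0 0 0 0) (lab 0 1 0 0) (
      q • monomial [lab 0 1 0 0, lab 0 0 0 0]) := by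
  have h : 1 + q ^ 2 ≠ 0 := fun h => hq2 (by linear_combination h)
  have h' : q ^ 2 + 1 ≠ 0 := by rwa [add_comm]
  refine isRule_of_eq (x :=
      ((-q ^ 2 - 1) / 2) • involRel q ((0, 0), (0, 1)) ((0, 0), (0, 0))) (by decide) ?_ ?_ ?_
  · exact monomial_mem_standardSpan (by rfl) (by decide) _
  · exact smul_involRel_mem hq hq2 _ _ _
  · simp [involRel, sum_involX_smul hq hq2, pairWord, diagCoeff, offCoeff]
    match_scalars <;> field_simp <;> ring

theorem isRule_1112_1211 {q : ℂ} (hq : q ≠ 0) (hq2 : q ^ 2 ≠ -1) :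
    IsRule q (lab 0 0 0 1) (lab 0 1 0 0) (
      (1 : ℂ) • monomial [lab 0 1 0 0, lab 0 0 0 1]) := by
  have h : 1 + q ^ 2 ≠ 0 := fun h => hq2 (by linear_combination h)
  have h' : q ^ 2 + 1 ≠ 0 := by rwa [add_comm]
  refine isRule_of_eq (x :=
      ((-q ^ 2 - 1) / (2 * q)) • involRel q ((0, 0), (0, 1)) ((0, 0), (0, 1))) (by decide) ?_ ?_ ?_
  · exact monomial_mem_standardSpan (by rfl) (by decide) _
  · exact smul_involRel_mem hq hq2 _ _ _
  · simp [involRel, sum_involX_smul hq hq2, pairWord, diagCoeff, offCoeff]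
    match_scalars <;> field_simp <;> ring

theorem isRule_1111_1212 {q : ℂ} (hq : q ≠ 0) (hq2 : q ^ 2 ≠ -1) :
    IsRule q (lab 0 0 0 0) (lab 0 1 0 1) (
      (1 : ℂ) • monomial [lab 0 1 0 1, lab 0 0 0 0] +
      ((q ^ 2 - 1) / q) • monomial [lab 0 1 0 0, lab 0 0 0 1]) := by
  have h : 1 + q ^ 2 ≠ 0 := fun h => hq2 (by linear_combination h)
  have h' : q ^ 2 + 1 ≠ 0 := by rwa [add_comm]
  refine isRule_of_eq (x :=
      ((-q ^ 4 + 1) / (2 * q ^ 2)) • involRel q ((0, 0), (0, 1)) ((0, 0), (0, 1)) +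
      ((-q ^ 2 - 1) / (2 * q)) • involRel q ((0, 0), (0, 1)) ((0, 1), (0, 0))) (by decide) ?_ ?_ ?_
  · exact Submodule.add_mem _ (monomial_mem_standardSpan (by rfl) (by decide) _)
      (monomial_mem_standardSpan (by rfl) (by decide) _)
  · exact Submodule.add_mem _ (smul_involRel_mem hq hq2 _ _ _)
      (smul_involRel_mem hq hq2 _ _ _)
  · simp [involRel, sum_involX_smul hq hq2, pairWord, diagCoeff, offCoeff]
    match_scalars <;> field_simp <;> ring

theorem isRule_1111_1221 {q : ℂ} (hq : q ≠ 0) (hq2 : q ^ 2 ≠ -1) :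
    IsRule q (lab 0 0 0 0) (lab 0 1 1 0) (
      (1 : ℂ) • monomial [lab 0 1 1 0, lab 0 0 0 0] +
      ((q ^ 2 - 1) / q) • monomial [lab 0 1 0 0, lab 0 0 1 0]) := by
  have h : 1 + q ^ 2 ≠ 0 := fun h => hq2 (by linear_combination h)
  have h' : q ^ 2 + 1 ≠ 0 := by rwa [add_comm]
  refine isRule_of_eq (x :=
      ((-q ^ 4 + 1) / (2 * q ^ 2)) • involRel q ((0, 0), (0, 1)) ((0, 0), (1, 0)) +
      ((-q ^ 2 - 1) / (2 * q)) • involRel q ((0, 0), (0, 1)) ((1, 0), (0, 0))) (by decide) ?_ ?_ ?_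
  · exact Submodule.add_mem _ (monomial_mem_standardSpan (by rfl) (by decide) _)
      (monomial_mem_standardSpan (by rfl) (by decide) _)
  · exact Submodule.add_mem _ (smul_involRel_mem hq hq2 _ _ _)
      (smul_involRel_mem hq hq2 _ _ _)
  · simp [involRel, sum_involX_smul hq hq2, pairWord, diagCoeff, offCoeff]
    match_scalars <;> field_simp <;> ring

/-- Both column indices differ between the two factors, so four relations, one for each arrangement
of the columns, have to be combined. -/
theorem isRule_1112_1221 {q : ℂ} (hq : q ≠ 0) (hq2 : q ^ 2 ≠ -1) :
    IsRule q (lab 0 0 0 1) (lab 0 1 1 0) (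
      ((-q ^ 2 + 1) / (q ^ 2 + 1)) • monomial [lab 0 1 1 1, lab 0 0 0 0] +
      ((2 * q) / (q ^ 2 + 1)) • monomial [lab 0 1 1 0, lab 0 0 0 1] +
      ((q ^ 2 - 1) / (q ^ 3 + q)) • monomial [lab 0 1 0 1, lab 0 0 1 0] +
      ((q ^ 2 - 1) / (q ^ 2 + 1)) • monomial [lab 0 1 0 0, lab 0 0 1 1]) := by
  have h : 1 + q ^ 2 ≠ 0 := fun h => hq2 (by linear_combination h)
  have h' : q ^ 2 + 1 ≠ 0 := by rwa [add_comm]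
  refine isRule_of_eq (x :=
      ((-q ^ 2 + 1) / (2 * q)) • involRel q ((0, 0), (0, 1)) ((0, 0), (1, 1)) +
      ((-q ^ 2 + 1) / (2 * q ^ 2)) • involRel q ((0, 0), (0, 1)) ((0, 1), (1, 0)) +
      (-1 : ℂ) • involRel q ((0, 0), (0, 1)) ((1, 0), (0, 1)) +
      ((q ^ 2 - 1) / (2 * q)) • involRel q ((0, 0), (0, 1)) ((1, 1), (0, 0))) (by decide) ?_ ?_ ?_
  · exact Submodule.add_mem _ (Submodule.add_mem _ (Submodule.add_mem _ (monomial_mem_standardSpan (by rfl) (by decide) _)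
      (monomial_mem_standardSpan (by rfl) (by decide) _))
      (monomial_mem_standardSpan (by rfl) (by decide) _))
      (monomial_mem_standardSpan (by rfl) (by decide) _)
  · exact Submodule.add_mem _ (Submodule.add_mem _ (Submodule.add_mem _ (smul_involRel_mem hq hq2 _ _ _)
      (smul_involRel_mem hq hq2 _ _ _))
      (smul_involRel_mem hq hq2 _ _ _))
      (smul_involRel_mem hq hq2 _ _ _)
  · simp [involRel, sum_involX_smul hq hq2, pairWord, diagCoeff, offCoeff]
    match_scalars <;> field_simp <;> ring

theorem isRule_1111_1222 {q : ℂ} (hq : q ≠ 0) (hq2 : q ^ 2 ≠ -1) :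
    IsRule q (lab 0 0 0 0) (lab 0 1 1 1) (
      ((2 * q) / (q ^ 2 + 1)) • monomial [lab 0 1 1 1, lab 0 0 0 0] +
      ((q ^ 2 - 1) / (q ^ 2 + 1)) • monomial [lab 0 1 1 0, lab 0 0 0 1] +
      ((q ^ 2 - 1) / (q ^ 2 + 1)) • monomial [lab 0 1 0 1, lab 0 0 1 0] +
      ((q ^ 3 - q) / (q ^ 2 + 1)) • monomial [lab 0 1 0 0, lab 0 0 1 1]) := by
  have h : 1 + q ^ 2 ≠ 0 := fun h => hq2 (by linear_combination h)
  have h' : q ^ 2 + 1 ≠ 0 := by rwa [add_comm]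
  refine isRule_of_eq (x :=
      ((-q ^ 2 + 1) / 2) • involRel q ((0, 0), (0, 1)) ((0, 0), (1, 1)) +
      ((-q ^ 2 + 1) / (2 * q)) • involRel q ((0, 0), (0, 1)) ((0, 1), (1, 0)) +
      ((-q ^ 2 + 1) / (2 * q)) • involRel q ((0, 0), (0, 1)) ((1, 0), (0, 1)) +
      (-1 : ℂ) • involRel q ((0, 0), (0, 1)) ((1, 1), (0, 0))) (by decide) ?_ ?_ ?_
  · exact Submodule.add_mem _ (Submodule.add_mem _ (Submodule.add_mem _ (monomial_mem_standardSpan (by rfl) (by decide) _)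
      (monomial_mem_standardSpan (by rfl) (by decide) _))
      (monomial_mem_standardSpan (by rfl) (by decide) _))
      (monomial_mem_standardSpan (by rfl) (by decide) _)
  · exact Submodule.add_mem _ (Submodule.add_mem _ (Submodule.add_mem _ (smul_involRel_mem hq hq2 _ _ _)
      (smul_involRel_mem hq hq2 _ _ _))
      (smul_involRel_mem hq hq2 _ _ _))
      (smul_involRel_mem hq hq2 _ _ _)
  · simp [involRel, sum_involX_smul hq hq2, pairWord, diagCoeff, offCoeff]
    match_scalars <;> field_simp <;> ring

/-! ### Reductions -/

/-- The elementary reduction that replaces `z_A z_B` by `f` between `l` and `r`. -/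
def rewriteMap {n m : ℕ} (l r : List (Gen n m)) (A B : Gen n m) (f : Free n m) :
    Free n m →ₗ[ℂ] Free n m :=
  wordLift fun w => if w = l ++ [A, B] ++ r then monomial l * f * monomial r else monomial w

theorem rewriteMap_monomial {n m : ℕ} (l r : List (Gen n m)) (A B : Gen n m) (f : Free n m)
    (w : List (Gen n m)) : rewriteMap l r A B f (monomial w) =
      if w = l ++ [A, B] ++ r then monomial l * f * monomial r else monomial w := by
  rw [rewriteMap, wordLift_monomial]

theorem Reduces.refl {n m : ℕ} (q : ℂ) (g : Free n m) : Reduces q g g :=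
  Relation.ReflTransGen.refl

theorem Reduces.rewrite {n m : ℕ} {q : ℂ} {g h : Free n m} (hg : Reduces q g h) {A B : Gen n m}
    {f : Free n m} (hr : IsRule q A B f) (l r : List (Gen n m)) :
    Reduces q g (rewriteMap l r A B f h) :=
  Relation.ReflTransGen.tail hg ⟨rewriteMap l r A B f, ⟨l, r, A, B, f, hr, by
    rw [rewriteMap_monomial, if_pos rfl], fun w hw => by
    rw [rewriteMap_monomial, if_neg hw]⟩, rfl⟩

/-- A rule changes a monomial by an element of the ideal, so composing an elementary reduction with
the quotient map gives the quotient map again. -/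
theorem toCoord_eq_of_reduces {n m : ℕ} {q : ℂ} {g h : Free n m} (hgh : Reduces q g h) :
    toCoord n m q g = toCoord n m q h := by
  induction hgh with
  | refl => rfl
  | tail _ hstep ih =>
    obtain ⟨ρ, ⟨l, r, A, B, f, hrule, hρ, hfix⟩, rfl⟩ := hstep
    have hle : relSpan n m q ≤ LinearMap.ker (toCoord n m q).toLinearMap := by
      rw [relSpan, Submodule.span_le]
      rintro - ⟨a, b, rfl⟩
      change toCoord n m q _ = 0
      rw [map_sub, toCoord_relLeft, sub_self]
    have hf : toCoord n m q (monomial [A, B]) = toCoord n m q f := by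
      rw [← sub_eq_zero, ← map_sub]
      exact hle hrule.2.2
    have hcomp : (toCoord n m q).toLinearMap ∘ₗ ρ = (toCoord n m q).toLinearMap := by
      refine hom_ext_monomial fun w => ?_
      change toCoord n m q (ρ (monomial w)) = toCoord n m q (monomial w)
      by_cases hw : w = l ++ [A, B] ++ r
      · rw [hw, hρ, monomial_append, monomial_append]
        simp only [map_mul, hf]
      · rw [hfix w hw]
    rw [ih]
    exact (LinearMap.congr_fun hcomp _).symm

theorem reduces_firstExpr {q : ℂ} (hq : q ≠ 0) (hq2 : q ^ 2 ≠ -1) :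
    Reduces q startMonomial (firstExpr q) := by
  have h : 1 + q ^ 2 ≠ 0 := fun h => hq2 (by linear_combination h)
  have h' : q ^ 2 + 1 ≠ 0 := by rwa [add_comm]
  have key := Reduces.refl q startMonomial
    -- The left pair of the overlap is resolved first.
    |>.rewrite (isRule_1111_1112 hq hq2) [] [lab 0 1 1 0]
    |>.rewrite (isRule_1111_1221 hq hq2) [lab 0 0 0 1] []
    |>.rewrite (isRule_1112_1211 hq hq2) [] [lab 0 0 1 0]
    |>.rewrite (isRule_1112_1121 hq hq2) [lab 0 1 0 0] []
    |>.rewrite (isRule_1112_1221 hq hq2) [] [lab 0 0 0 0]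
  convert key using 1
  simp only [startMonomial, firstExpr]
  simp [rewriteMap_monomial, mul_add, add_mul, smul_add, ← monomial_append]
  match_scalars <;> field_simp <;> ring

theorem reduces_secondExpr {q : ℂ} (hq : q ≠ 0) (hq2 : q ^ 2 ≠ -1) :
    Reduces q startMonomial (secondExpr q) := by
  have h : 1 + q ^ 2 ≠ 0 := fun h => hq2 (by linear_combination h)
  have h' : q ^ 2 + 1 ≠ 0 := by rwa [add_comm]
  have key := Reduces.refl q startMonomial
    -- The right pair is resolved first, which creates four monomials; the remaining steps put them
    -- and their descendants in order.
    |>.rewrite (isRule_1112_1221 hq hq2) [lab 0 0 0 0] []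
    |>.rewrite (isRule_1111_1212 hq hq2) [] [lab 0 0 1 0]
    |>.rewrite (isRule_1111_1221 hq hq2) [] [lab 0 0 0 1]
    |>.rewrite (isRule_1111_1112 hq hq2) [lab 0 1 1 0] []
    |>.rewrite (isRule_1111_1121 hq hq2) [lab 0 1 0 1] []
    |>.rewrite (isRule_1111_1222 hq hq2) [] [lab 0 0 0 0]
    |>.rewrite (isRule_1112_1121 hq hq2) [lab 0 1 0 0] []
    |>.rewrite (isRule_1111_1211 hq hq2) [] [lab 0 0 1 1]
    |>.rewrite (isRule_1111_1122 hq hq2) [lab 0 1 0 0] []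
  convert key using 1
  simp only [startMonomial, secondExpr]
  simp [rewriteMap_monomial, mul_add, add_mul, smul_add, ← monomial_append]
  match_scalars <;> field_simp <;> ring

theorem firstExpr_mem_standardSpan (q : ℂ) : firstExpr q ∈ standardSpan 2 2 3 := by
  rw [firstExpr]
  exact Submodule.add_mem _ (Submodule.add_mem _ (Submodule.add_mem _ (Submodule.add_mem _ (monomial_mem_standardSpan (by rfl) (by decide) _)
    (monomial_mem_standardSpan (by rfl) (by decide) _))
    (monomial_mem_standardSpan (by rfl) (by decide) _))
    (monomial_mem_standardSpan (by rfl) (by decide) _))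
    (monomial_mem_standardSpan (by rfl) (by decide) _)

theorem secondExpr_mem_standardSpan (q : ℂ) : secondExpr q ∈ standardSpan 2 2 3 := by
  rw [secondExpr, smul_sub, smul_smul]
  exact Submodule.add_mem _ (Submodule.add_mem _ (Submodule.add_mem _ (monomial_mem_standardSpan (by rfl) (by decide) _)
    (monomial_mem_standardSpan (by rfl) (by decide) _))
    (monomial_mem_standardSpan (by rfl) (by decide) _))
    (Submodule.sub_mem _ (monomial_mem_standardSpan (by rfl) (by decide) _)
      (monomial_mem_standardSpan (by rfl) (by decide) _))

theorem firstExpr_ne_secondExpr {q : ℂ} (hq : q ≠ 0) (h1 : q ^ 2 ≠ 1) (h2 : 1 + q ^ 2 ≠ 0) :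
    firstExpr q ≠ secondExpr q := by
  intro h
  -- The coefficients of `z_{12,11} z_{11,22} z_{11,11}` are `q (q² - 1) / (1 + q²)` and `2 / (1 +
  -- q²)` times that, so they agree only if `q² = 1`.
  have h3 := congrArg (wordLift fun w =>
    if w = [lab 0 1 0 0, lab 0 0 1 1, lab 0 0 0 0] then (1 : ℂ) else 0) h
  simp [firstExpr, secondExpr] at h3
  field_simp at h3
  exact h1 (by linear_combination h3)

end

end QMat

/-! ### The theorem for two-dimensional `V` and `W` -/

theorem proposition5p4 (q : ℝ) (hq : 0 < q) (hqt : Transcendental ℚ q) :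
    -- the Poincaré series differs from the classical one, which is the one at `q = 1`
    QMat.poincareSeries 2 2 q ≠ QMat.classicalPoincareSeries 2 2 ∧
    QMat.poincareSeries 2 2 1 = QMat.classicalPoincareSeries 2 2 ∧
    -- the dimensions in degree 3
    Module.finrank ℂ (QMat.component 2 2 q 3) = 688 ∧
    Module.finrank ℂ (MvPolynomial.homogeneousSubmodule (QMat.Gen 2 2) ℂ 3) = 816 ∧
    -- the relations are equivalent to a reduction system, with one rule for each nonstandard
    -- monomial of degree 2
    (∀ A B : QMat.Gen 2 2, ¬ QMat.IsStandard [A, B] → ∃! f, QMat.IsRule (q : ℂ) A B f) ∧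
    -- two reductions of one monomial to distinct combinations of standard monomials
    (QMat.Reduces (q : ℂ) QMat.startMonomial (QMat.firstExpr q) ∧
      QMat.Reduces (q : ℂ) QMat.startMonomial (QMat.secondExpr q) ∧
      QMat.firstExpr q ∈ QMat.standardSpan 2 2 3 ∧
      QMat.secondExpr q ∈ QMat.standardSpan 2 2 3 ∧
      QMat.firstExpr q ≠ QMat.secondExpr q) ∧
    -- the resulting nontrivial relation among standard monomials
    QMat.toCoord 2 2 q (QMat.firstExpr q) = QMat.toCoord 2 2 q (QMat.secondExpr q) ∧
    -- the failure of the diamond property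
    ¬ QMat.DiamondProperty 2 2 q := by
  have hq0 : (q : ℂ) ≠ 0 := by exact_mod_cast hq.ne'
  -- Transcendence enters only by excluding `q = 1`; the other nonvanishing conditions follow from
  -- `q` being real and positive.
  have hq1 : q ≠ 1 := by
    rintro rfl
    exact hqt isAlgebraic_one
  have h1 : (q : ℂ) ^ 2 ≠ 1 := by
    intro h
    have h' : q ^ 2 = 1 := by exact_mod_cast h
    exact hq1 ((pow_eq_one_iff_of_nonneg hq.le two_ne_zero).1 h')
  have h2 : 1 + (q : ℂ) ^ 2 ≠ 0 := by
    have : (1 + q ^ 2 : ℝ) ≠ 0 := by positivity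
    exact_mod_cast this
  have h3 : 1 + (q : ℂ) ^ 2 + (q : ℂ) ^ 4 ≠ 0 := by
    have : (1 + q ^ 2 + q ^ 4 : ℝ) ≠ 0 := by positivity
    exact_mod_cast this
  have h4 : 1 + (q : ℂ) ^ 4 ≠ 0 := by
    have : (1 + q ^ 4 : ℝ) ≠ 0 := by positivity
    exact_mod_cast this
  have hq2 : (q : ℂ) ^ 2 ≠ -1 := fun h => h2 (by linear_combination h)
  have hdim : Module.finrank ℂ (QMat.component 2 2 q 3) = 688 :=
    QMat.finrank_component_three_two hq0 h1 h2 h3 h4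
  have hclass : Module.finrank ℂ (MvPolynomial.homogeneousSubmodule (QMat.Gen 2 2) ℂ 3) = 816 := by
    rw [QMat.finrank_homogeneousSubmodule, Nat.multichoose_eq]
    simp [Nat.choose]
  have hne := QMat.firstExpr_ne_secondExpr hq0 h1 h2
  have hr1 := QMat.reduces_firstExpr hq0 hq2
  have hr2 := QMat.reduces_secondExpr hq0 hq2
  have hs1 := QMat.firstExpr_mem_standardSpan q
  have hs2 := QMat.secondExpr_mem_standardSpan q
  refine ⟨fun h => ?_, QMat.poincareSeries_one 2 2, hdim, hclass,
    fun A B hAB => QMat.existsUnique_isRule hq0 hq2 A B hAB, ⟨hr1, hr2, hs1, hs2, hne⟩,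
    (QMat.toCoord_eq_of_reduces hr1).symm.trans (QMat.toCoord_eq_of_reduces hr2),
    fun hD => hne (hD _ _ _ _ _ hr1 hs1 hr2 hs2)⟩
  -- The two series already differ in the coefficient of `t³`.
  have h' := congrArg (PowerSeries.coeff 3) h
  rw [QMat.poincareSeries, QMat.classicalPoincareSeries, PowerSeries.coeff_mk,
    PowerSeries.coeff_mk, hdim, hclass] at h'
  norm_num at h'
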